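/- Consider the Gaussian linear model with random design: the data $\mathbf D=(D_1,\dots,D_n)$ consist of i.i.d. triplets $D_i=(y_i,Z_i,\mathbf W_i)\in\mathbb R\times\mathbb R\times\mathbb R^{p-1}$ with $y_i=Z_i\beta+\mathbf W_i^\top\boldsymbol\gamma+\varepsilon_i$, where $X_i=(Z_i,\mathbf W_i^\top)^\top\sim\mathcal N_p(0,\boldsymbol\Sigma)$ is independent of $\varepsilon_i\sim\mathcal N(0,\sigma^2)$. Write $\theta=(\beta,\boldsymbol\gamma,\boldsymbol\Sigma,\sigma)$, let $\mathbb P_\theta$, $\mathbb E_\theta$ be the law of $\mathbf D$ and its expectation, and let $\boldsymbol\Omega_{1,}$ be the first row of $\boldsymbol\Omega=\boldsymbol\Sigma^{-1}$. Fix constants $M>1$ and $M_1,M_2>0$. For an integer $s$, let $\widetilde\Theta(s)$ be the set of all $\theta$ such that $M^{-1}\le\lambda_{\min}(\boldsymbol\Sigma)\le\lambda_{\max}(\boldsymbol\Sigma)\le M$, $0\le\sigma\le M_1$, $\|(\beta,\boldsymbol\gamma^\top)^\top\|_2\le M_2$ and $\boldsymbol\Omega_{1,}$ has at most $s$ non-zero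 entries, and let $\Theta(s)$ be the set of those $\theta\in\widetilde\Theta(s)$ for which in addition the covariance matrix of $\mathbf W_i$ (the matrix $\boldsymbol\Sigma$ without its first row and column) is the identity $\mathbb I_{p-1}$. For a set $\Theta_1$ of parameters, let $\mathcal C_\alpha(\Theta_1)$ be the set of all intervals $[l(\mathbf D),u(\mathbf D)]$ with $\mathbb P_\theta\bigl(l(\mathbf D)\le\beta\le u(\mathbf D)\bigr)\ge 1-\alpha$ for all $\theta\in\Theta_1$. Let $c<1/2$ and $\alpha\in(0,1/3)$ be constants. Then there is a constant $C>0$, depending only on $M,M_1,M_2,c,\alpha$, such that for all positive integers $n,p,s$ with $sn^{-1}\log p\le 1/4$ and $2\le s\le p^{c}$, \[ \inf_{\mathcal{CI}\in\mathcal C_\alpha(\Theta(s))}\ \sup_{\theta\in\Theta(s)}\ \mathbb E_\theta\,\mathrm{diam}(\mathcal{CI})\ \ge\ C\left(n^{-1/2}+sn^{-1}\log p\right), \] where $\mathrm{diam}$ denotes the length of an interval, and the same inequality holds with $\Theta(s)$ replaced by $\widetilde\Theta(s)$ in both places. -/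

import Mathlib

open MeasureTheory ProbabilityTheory

noncomputable section

namespace DenseLinearModel

/-- A parameter `θ = (β, γ, Σ, σ)` of the Gaussian linear model with `p = q + 1` regressors:
the coordinate `0` of the regressor vector is `Z`, the remaining `q = p - 1` ones are `W`. -/
structure Param (q : ℕ) where
  /-- the coefficient of interest -/
  β : ℝ
  /-- the nuisance coefficients -/
  γ : Fin q → ℝ
  /-- the covariance matrix of the regressor vector `X = (Z, W)` -/
  cov : Matrix (Fin (q + 1)) (Fin (q + 1)) ℝ
  /-- the noise level (standard deviation of the noise) -/
  σ : ℝ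

/-- The full coefficient vector `(β, γᵀ)ᵀ ∈ ℝᵖ`, with the Euclidean norm. -/
def Param.coeff {q : ℕ} (θ : Param q) : EuclideanSpace ℝ (Fin (q + 1)) :=
  WithLp.toLp 2 (Fin.cons θ.β θ.γ)

/-- The first row of the precision matrix `Ω = Σ⁻¹`. -/
def Param.precisionRow {q : ℕ} (θ : Param q) : Fin (q + 1) → ℝ :=
  fun j => (θ.cov)⁻¹ 0 j

/-- One observation `(y, Z, W)`. -/
abbrev Obs (q : ℕ) : Type := ℝ × ℝ × (Fin q → ℝ)

/-- A data set of `n` observations. -/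
abbrev Data (n q : ℕ) : Type := Fin n → Obs q

/-- The law of one observation `(y, Z, W)`: `X = (Z, W) ∼ N(0, Σ)` and `ε ∼ N(0, σ²)` are
independent, and `y = Z β + Wᵀ γ + ε`. -/
def obsLaw {q : ℕ} (θ : Param q) : Measure (Obs q) :=
  ((multivariateGaussian 0 θ.cov).prod (gaussianReal 0 (Real.toNNReal (θ.σ ^ 2)))).map
    (fun w : EuclideanSpace ℝ (Fin (q + 1)) × ℝ =>
      (w.1 0 * θ.β + ∑ j : Fin q, w.1 j.succ * θ.γ j + w.2,
        w.1 0, fun j : Fin q => w.1 j.succ))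

/-- The law `P_θ` of `n` i.i.d. observations. -/
def dataLaw (n : ℕ) {q : ℕ} (θ : Param q) : Measure (Data n q) :=
  Measure.pi (fun _ : Fin n => obsLaw θ)

/-- The parameter space `Θ̃`: all eigenvalues of the (symmetric) matrix `Σ` lie in `[M⁻¹, M]`,
`0 ≤ σ ≤ M₁`, and the full coefficient vector has Euclidean norm at most `M₂`. -/
def thetaTildeFull (M M₁ M₂ : ℝ) (q : ℕ) : Set (Param q) :=
  {θ | (∃ hS : θ.cov.IsHermitian, ∀ i, M⁻¹ ≤ hS.eigenvalues i ∧ hS.eigenvalues i ≤ M) ∧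
    0 ≤ θ.σ ∧ θ.σ ≤ M₁ ∧ ‖θ.coeff‖ ≤ M₂}

/-- The parameter space `Θ`: as `Θ̃`, and moreover `W` has identity covariance matrix. -/
def thetaFull (M M₁ M₂ : ℝ) (q : ℕ) : Set (Param q) :=
  {θ | θ ∈ thetaTildeFull M M₁ M₂ q ∧ θ.cov.submatrix Fin.succ Fin.succ = 1}

/-- `Θ̃(s)`: the parameters in `Θ̃` for which the first row of the precision matrix has at most
`s` non-zero entries. -/
def thetaTilde (M M₁ M₂ : ℝ) (q s : ℕ) : Set (Param q) :=
  {θ | θ ∈ thetaTildeFull M M₁ M₂ q ∧ hammingNorm θ.precisionRow ≤ s}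

/-- `Θ(s)`: the parameters in `Θ` for which the first row of the precision matrix has at most
`s` non-zero entries. -/
def theta (M M₁ M₂ : ℝ) (q s : ℕ) : Set (Param q) :=
  {θ | θ ∈ thetaFull M M₁ M₂ q ∧ hammingNorm θ.precisionRow ≤ s}

/-- The class `𝒞_α(Θ₁)` of `(1 - α)` confidence intervals `[l(D), u(D)]` for `β` over `Θ₁`,
each given by its pair of (measurable) endpoint functions. -/
def confInt (n : ℕ) {q : ℕ} (α : ℝ) (Θ₁ : Set (Param q)) :
    Set ((Data n q → ℝ) × (Data n q → ℝ)) :=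
  {I | Measurable I.1 ∧ Measurable I.2 ∧
    ∀ θ ∈ Θ₁, ENNReal.ofReal (1 - α) ≤ dataLaw n θ {D | I.1 D ≤ θ.β ∧ θ.β ≤ I.2 D}}

/-- The minimax expected length
`inf_{CI ∈ 𝒞_α(Θ₁)} sup_{θ ∈ Θ₁} E_θ diam(CI)`, as an element of `[0, ∞]`. -/
def minimaxLength (n : ℕ) {q : ℕ} (α : ℝ) (Θ₁ : Set (Param q)) : ENNReal :=
  ⨅ I ∈ confInt n α Θ₁, ⨆ θ ∈ Θ₁,
    ∫⁻ D, Metric.ediam (Set.Icc (I.1 D) (I.2 D)) ∂(dataLaw n θ)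

end DenseLinearModel

end

/-! The bound is Le Cam's method with a point null and a mixture of alternatives that share one
value `b` of the coefficient of interest. An interval with coverage above `2/3` on both sides, where
the mixture exceeds the null by at most `1/6` on any event, contains the null value and `b`
simultaneously with null probability at least `1/6`; its expected length is then at least `|θ₀.β -
b| / 6` (`le_minimaxLength_of_mixture`). The closeness of the mixture comes from the second moment
of its likelihood ratio (`mixture_le_add`).

For the rate `s log p / n`, `Z` gets covariance `v` with `W`, and `γ`, `β`, `σ` are tuned so that
`y` has standard deviation `τ`, is uncorrelated with `Z`, and `y/τ` has the same covariance `v` with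
`W` (`confoundedParam`). Then `β` has absolute value `τ‖v‖²/(1 - ‖v‖²)`, quadratic in `v`. In the
rotated coordinates `(y/τ + Z)/√2` and `(y/τ - Z)/√2`, only the first depends on `W`, with
regression coefficients `√2 v`, and all marginals stay standard (`obsLaw_confoundedParam`). The null
`v = 0` is pure noise. For two coefficient vectors `ω`, `η` of such a response the likelihood ratios
satisfy `E[L_ω L_η] = 1/(1 - ⟨ω, η⟩)` per observation (`lintegral_likelihood_mul`).

Let `v` carry `k = s - 1` spikes of squared height `r` of order `log p / n`, one in each of `k`
blocks of size `m` about `p/k`. All alternatives share `‖v‖² = rk`, hence the same `β`, while random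
supports rarely overlap: the second moment is at most `exp(k exp(4rn)/m)`, and `c < 1/2` makes
`k²/p` a negative power of `p` that absorbs `exp(4rn)` (`sum_second_moment_le`). The rate `n^{-1/2}`
is the two-point case with independent regressors (`parametric_le_minimaxLength`). -/

noncomputable section

namespace DenseLinearModel

/-! ### Product densities and the second-moment method -/

/-- A finite power of a measure with a density has the product density. -/
theorem pi_withDensity_prod {X ι : Type*} [Fintype ι] [MeasurableSpace X] (μ : Measure X)
    [IsProbabilityMeasure μ] (f : X → ENNReal) (hf : Measurable f)
    [SigmaFinite (μ.withDensity f)] :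
    Measure.pi (fun _ : ι => μ.withDensity f) =
      (Measure.pi fun _ : ι => μ).withDensity (fun x => ∏ i, f (x i)) := by
  classical
  refine (Measure.pi_eq fun s hs => ?_)
  have h1 : ∀ i, μ.withDensity f (s i) = ∫⁻ x, (s i).indicator f x ∂μ := fun i => by
    rw [withDensity_apply _ (hs i), lintegral_indicator (hs i)]
  rw [withDensity_apply _ (MeasurableSet.univ_pi hs), ← lintegral_indicator (MeasurableSet.univ_pi hs)]
  simp_rw [h1]
  have := lintegral_prod_eq_prod_lintegral_of_indepFun (μ := Measure.pi fun _ : ι => μ)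
    Finset.univ (fun i (x : ι → X) => (s i).indicator f (x i))
    (iIndepFun_pi (fun i => (hf.indicator (hs i)).aemeasurable))
    (fun i => (hf.indicator (hs i)).comp (measurable_pi_apply i))
  have h2 : ∀ i, ∫⁻ x : ι → X, (s i).indicator f (x i) ∂(Measure.pi fun _ : ι => μ)
      = ∫⁻ x, (s i).indicator f x ∂μ := fun i =>
    (measurePreserving_eval (fun _ : ι => μ) i).lintegral_comp (hf.indicator (hs i))
  simp_rw [h2] at this
  rw [← this]
  refine lintegral_congr fun x => ?_
  by_cases hx : x ∈ Set.univ.pi s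
  · rw [Set.indicator_of_mem hx]
    exact Finset.prod_congr rfl fun i _ => (Set.indicator_of_mem (hx i trivial) _).symm
  · rw [Set.indicator_of_notMem hx]
    simp only [Set.mem_pi, Set.mem_univ, true_implies, not_forall] at hx
    obtain ⟨i, hi⟩ := hx
    exact (Finset.prod_eq_zero (Finset.mem_univ i) (Set.indicator_of_notMem hi _)).symm

/-- The integral of a product of functions of the single coordinates factorizes. -/
theorem lintegral_pi_prod {X ι : Type*} [Fintype ι] [MeasurableSpace X] (μ : Measure X)
    [IsProbabilityMeasure μ] (f : X → ENNReal) (hf : Measurable f) :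
    ∫⁻ x, ∏ i, f (x i) ∂(Measure.pi fun _ : ι => μ) = (∫⁻ x, f x ∂μ) ^ Fintype.card ι := by
  have := lintegral_prod_eq_prod_lintegral_of_indepFun (μ := Measure.pi fun _ : ι => μ)
    Finset.univ (fun i (x : ι → X) => f (x i))
    (iIndepFun_pi (fun i => hf.aemeasurable))
    (fun i => hf.comp (measurable_pi_apply i))
  rw [this, Finset.prod_congr rfl fun i _ =>
    (measurePreserving_eval (fun _ : ι => μ) i).lintegral_comp hf]
  simp

/-- This is `b (g - 1) ≤ 3 (g - 1)² + b²/12` for an indicator value `b`, rearranged to avoid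
subtraction in `[0, ∞]`. With `∫ (g - 1)² ≤ 1/36` the right side integrates to at most `1/12 + 1/12
= 1/6`. -/
theorem ennreal_mul_add_le (g : ENNReal) (b : ENNReal) (hb : b = 0 ∨ b = 1) :
    g * b + 6 * g ≤ b + 3 * (g * g) + 37 / 12 := by
  by_cases hg : g = ⊤
  · subst hg; simp
  lift g to NNReal using hg
  have h : (37 / 12 : ENNReal) = ((37 / 12 : NNReal) : ENNReal) := by
    rw [ENNReal.coe_div (by norm_num)]; rfl
  rw [h]
  rcases hb with rfl | rfl
  · simp only [mul_zero, zero_add]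
    have : (6 * g : NNReal) ≤ 3 * (g * g) + 37 / 12 := by
      rw [← NNReal.coe_le_coe]; push_cast
      nlinarith [sq_nonneg ((g : ℝ) - 1)]
    exact_mod_cast this
  · have : (g * 1 + 6 * g : NNReal) ≤ 1 + 3 * (g * g) + 37 / 12 := by
      rw [← NNReal.coe_le_coe]; push_cast
      nlinarith [sq_nonneg (6 * (g : ℝ) - 7)]
    exact_mod_cast this

/-- If the likelihood ratios of a mixture have second moment at most `37/36`, then the mixture
exceeds the base measure by at most `1/6` on every event. -/
theorem mixture_le_add {X ι : Type*} [Fintype ι] [Nonempty ι] [MeasurableSpace X] (μ : Measure X)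
    [IsProbabilityMeasure μ] (f : ι → X → ENNReal) (hf : ∀ i, Measurable (f i))
    [∀ i, IsProbabilityMeasure (μ.withDensity (f i))]
    (h2 : ∑ i, ∑ j, ∫⁻ x, f i x * f j x ∂μ ≤ 37 / 36 * (Fintype.card ι : ENNReal) ^ 2)
    {F : Set X} (hF : MeasurableSet F) :
    (Fintype.card ι : ENNReal)⁻¹ * ∑ i, μ.withDensity (f i) F ≤ μ F + 1 / 6 := by
  set N : ENNReal := (Fintype.card ι : ENNReal) with hN
  have hN0 : N ≠ 0 := by simp [hN]
  have hNt : N ≠ ⊤ := by simp [hN]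
  set g : X → ENNReal := fun x => N⁻¹ * ∑ i, f i x with hg
  have hgm : Measurable g := (Finset.measurable_sum _ fun i _ => hf i).const_mul _
  have hS : ∀ s : Set X, MeasurableSet s →
      ∫⁻ x, g x * s.indicator 1 x ∂μ = N⁻¹ * ∑ i, μ.withDensity (f i) s := by
    intro s hs
    have : ∀ x, g x * s.indicator 1 x = s.indicator g x := fun x => by
      by_cases hx : x ∈ s <;> simp [hx]
    simp_rw [this]
    rw [lintegral_indicator hs, lintegral_const_mul _ (Finset.measurable_sum _ fun i _ => hf i),
      lintegral_finsetSum _ fun i _ => hf i]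
    simp_rw [withDensity_apply _ hs]
  have hg1 : ∫⁻ x, g x ∂μ = 1 := by
    have := hS Set.univ MeasurableSet.univ
    simp only [Set.indicator_univ, Pi.one_apply, mul_one, measure_univ, Finset.sum_const,
      Finset.card_univ, nsmul_eq_mul] at this
    rw [this]; exact ENNReal.inv_mul_cancel hN0 hNt
  have hgg : ∫⁻ x, g x * g x ∂μ ≤ 37 / 36 := by
    have : ∀ x, g x * g x = (N⁻¹ * N⁻¹) * ∑ i, ∑ j, f i x * f j x := fun x => by
      simp only [hg]
      rw [← Finset.sum_mul_sum]; ring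
    simp_rw [this]
    rw [lintegral_const_mul _ (by fun_prop), lintegral_finsetSum _ (fun i _ => by fun_prop)]
    have h3 : ∀ i, ∫⁻ x, ∑ j, f i x * f j x ∂μ = ∑ j, ∫⁻ x, f i x * f j x ∂μ := fun i =>
      lintegral_finsetSum _ fun j _ => (hf i).mul (hf j)
    simp_rw [h3]
    calc _ ≤ N⁻¹ * N⁻¹ * (37 / 36 * N ^ 2) := by gcongr
      _ = 37 / 36 * ((N⁻¹ * N) * (N⁻¹ * N)) := by ring
      _ = _ := by rw [ENNReal.inv_mul_cancel hN0 hNt]; simp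
  have key : ∫⁻ x, (g x * F.indicator 1 x + 6 * g x) ∂μ ≤
      ∫⁻ x, (F.indicator 1 x + 3 * (g x * g x) + 37 / 12) ∂μ :=
    lintegral_mono fun x => ennreal_mul_add_le _ _ (by by_cases hx : x ∈ F <;> simp [hx])
  have hI : Measurable (F.indicator (1 : X → ENNReal)) := measurable_one.indicator hF
  rw [lintegral_add_right _ (by fun_prop), hS F hF, lintegral_const_mul _ hgm, hg1,
    lintegral_add_right _ measurable_const, lintegral_add_left hI,
    lintegral_const_mul _ (by fun_prop), lintegral_indicator_one hF] at key
  simp only [lintegral_const, measure_univ, mul_one] at key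
  -- The excess over the `6 = 6 ∫ g` on the left is exactly `1/6`; the common summand `6` is
  -- cancelled below.
  have e : μ F + 3 * (37 / 36) + 37 / 12 = (μ F + 1 / 6) + 6 := by
    have : (3 * (37 / 36) + 37 / 12 : ENNReal) = 1 / 6 + 6 := by
      rw [← ENNReal.toReal_eq_toReal_iff' (by finiteness) (by finiteness)]
      rw [ENNReal.toReal_add (by finiteness) (by finiteness),
        ENNReal.toReal_add (by finiteness) (by finiteness)]
      norm_num [ENNReal.toReal_mul, ENNReal.toReal_div]
    rw [add_assoc, this, add_assoc]
  have : N⁻¹ * ∑ i, μ.withDensity (f i) F + 6 ≤ (μ F + 1 / 6) + 6 := by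
    rw [← e]; exact key.trans (by gcongr)
  exact (ENNReal.add_le_add_iff_right (by norm_num)).1 this

/-! ### Reduction of the minimax length to testing -/

theorem isProbabilityMeasure_obsLaw {q : ℕ} (θ : Param q) : IsProbabilityMeasure (obsLaw θ) := by
  unfold obsLaw
  exact Measure.isProbabilityMeasure_map (Measurable.aemeasurable (by fun_prop))

theorem isProbabilityMeasure_dataLaw (n : ℕ) {q : ℕ} (θ : Param q) :
    IsProbabilityMeasure (dataLaw n θ) := by
  have := isProbabilityMeasure_obsLaw θ
  unfold dataLaw; infer_instance

/-- Enlarging the parameter set shrinks the class of admissible intervals and enlarges the supremum,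
so both effects point the same way. It transfers the bound from `Θ(s)` to `Θ̃(s)`. -/
theorem minimaxLength_mono {n q : ℕ} {α : ℝ} {Θ₁ Θ₂ : Set (Param q)} (h : Θ₁ ⊆ Θ₂) :
    minimaxLength n α Θ₁ ≤ minimaxLength n α Θ₂ := by
  unfold minimaxLength
  refine le_iInf₂ fun I hI => (iInf₂_le I ⟨hI.1, hI.2.1, fun θ hθ => hI.2.2 θ (h hθ)⟩).trans ?_
  exact iSup₂_le fun θ hθ => le_iSup₂ (f := fun θ (_ : θ ∈ Θ₂) =>
    ∫⁻ D, Metric.ediam (Set.Icc (I.1 D) (I.2 D)) ∂(dataLaw n θ)) θ (h hθ)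

/-- Lower bound on the minimax length from a point null and a mixture of alternatives, all with
the same value of the coefficient of interest. -/
theorem le_minimaxLength_of_mixture {n q : ℕ} {α : ℝ} (hα₁ : α < 1 / 3)
    {Θ₁ : Set (Param q)} {ι : Type*} [Fintype ι] [Nonempty ι] (θ₀ : Param q) (θ : ι → Param q)
    (b : ℝ) (h₀ : θ₀ ∈ Θ₁) (h₁ : ∀ i, θ i ∈ Θ₁) (hb : ∀ i, (θ i).β = b)
    (hmix : ∀ F : Set (Data n q), MeasurableSet F →
      (Fintype.card ι : ENNReal)⁻¹ * ∑ i, dataLaw n (θ i) F ≤ dataLaw n θ₀ F + 1 / 6) :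
    ENNReal.ofReal (|θ₀.β - b| / 6) ≤ minimaxLength n α Θ₁ := by
  unfold minimaxLength
  refine le_iInf₂ fun I hI => ?_
  refine le_trans ?_ (le_iSup₂ (f := fun θ (_ : θ ∈ Θ₁) =>
    ∫⁻ D, Metric.ediam (Set.Icc (I.1 D) (I.2 D)) ∂(dataLaw n θ)) θ₀ h₀)
  obtain ⟨m1, m2, hcov⟩ := hI
  have := isProbabilityMeasure_dataLaw n θ₀
  set μ := dataLaw n θ₀
  have hm : ∀ t : ℝ, MeasurableSet {D | I.1 D ≤ t ∧ t ≤ I.2 D} := fun t =>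
    (measurableSet_le m1 measurable_const).inter (measurableSet_le measurable_const m2)
  set A := {D | I.1 D ≤ θ₀.β ∧ θ₀.β ≤ I.2 D}
  set B := {D | I.1 D ≤ b ∧ b ≤ I.2 D}
  have hA : ENNReal.ofReal (1 - α) ≤ μ A := hcov θ₀ h₀
  have hB : ENNReal.ofReal (1 - α) ≤ μ B + 1 / 6 := by
    refine le_trans ?_ (hmix B (hm b))
    have : ∀ i, ENNReal.ofReal (1 - α) ≤ dataLaw n (θ i) B := fun i => by
      have := hcov (θ i) (h₁ i)
      rwa [hb i] at this
    calc ENNReal.ofReal (1 - α) = (Fintype.card ι : ENNReal)⁻¹ * ∑ _i : ι, ENNReal.ofReal (1 - α) := by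
          rw [Finset.sum_const, nsmul_eq_mul, ← mul_assoc, Finset.card_univ,
            ENNReal.inv_mul_cancel (by simp) (by simp), one_mul]
      _ ≤ _ := by gcongr with i; exact this i
  -- Inclusion-exclusion: `(1 - α) + (1 - α - 1/6) - 1 ≥ 1/6`, since `α < 1/3`.
  have hAB : (1 / 6 : ENNReal) ≤ μ (A ∩ B) := by
    have hu := measure_union_add_inter A (hm b) (μ := μ)
    have hA' : 1 - α ≤ μ.real A := by
      rw [measureReal_def]; exact (ENNReal.ofReal_le_iff_le_toReal (by finiteness)).1 hA
    have hB' : 1 - α ≤ μ.real B + 1 / 6 := by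
      have := (ENNReal.ofReal_le_iff_le_toReal (by finiteness)).1 hB
      rw [ENNReal.toReal_add (by finiteness) (by finiteness)] at this
      simpa [measureReal_def] using this
    have hu' : μ.real (A ∪ B) + μ.real (A ∩ B) = μ.real A + μ.real B :=
      measureReal_union_add_inter (hm b)
    have h1 : μ.real (A ∪ B) ≤ 1 := measureReal_le_one
    have : (1 / 6 : ℝ) ≤ μ.real (A ∩ B) := by linarith
    rw [measureReal_def] at this
    have := (ENNReal.ofReal_le_iff_le_toReal (measure_ne_top _ _)).2 this
    refine le_trans (le_of_eq ?_) this
    rw [ENNReal.ofReal_div_of_pos (by norm_num)]; simp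
  calc ENNReal.ofReal (|θ₀.β - b| / 6) = ENNReal.ofReal |θ₀.β - b| * (1 / 6) := by
        rw [ENNReal.ofReal_div_of_pos (by norm_num)]; simp [div_eq_mul_inv]
    _ ≤ ENNReal.ofReal |θ₀.β - b| * μ (A ∩ B) := by gcongr
    _ = ∫⁻ D in A ∩ B, ENNReal.ofReal |θ₀.β - b| ∂μ := by simp
    _ ≤ ∫⁻ D in A ∩ B, Metric.ediam (Set.Icc (I.1 D) (I.2 D)) ∂μ := by
        refine setLIntegral_mono' ((hm _).inter (hm b)) fun D hD => ?_
        have := Metric.edist_le_ediam_of_mem (s := Set.Icc (I.1 D) (I.2 D)) hD.1 hD.2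
        rwa [edist_dist, Real.dist_eq] at this
    _ ≤ _ := setLIntegral_le_lintegral _ _

/-- The mixture bound for laws of samples that are images of laws with densities with respect to a
common base law. -/
theorem dataLaw_mixture_le {n q : ℕ} {X ι : Type*} [Fintype ι] [Nonempty ι] [MeasurableSpace X]
    (μ : Measure X) [IsProbabilityMeasure μ] (T : X → Obs q) (hT : Measurable T)
    (f : ι → X → ENNReal) (hf : ∀ i, Measurable (f i)) (θ₀ : Param q) (θ : ι → Param q)
    [∀ i, IsProbabilityMeasure (μ.withDensity (f i))]
    (h₀ : obsLaw θ₀ = μ.map T) (hθ : ∀ i, obsLaw (θ i) = (μ.withDensity (f i)).map T)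
    (h2 : ∑ i, ∑ j, (∫⁻ x, f i x * f j x ∂μ) ^ n ≤ 37 / 36 * (Fintype.card ι : ENNReal) ^ 2)
    {F : Set (Data n q)} (hF : MeasurableSet F) :
    (Fintype.card ι : ENNReal)⁻¹ * ∑ i, dataLaw n (θ i) F ≤ dataLaw n θ₀ F + 1 / 6 := by
  have hmap : ∀ ν : Measure X, IsProbabilityMeasure ν →
      Measure.pi (fun _ : Fin n => ν.map T) =
        (Measure.pi (fun _ : Fin n => ν)).map (fun d i => T (d i)) := fun ν hν => by
    have := Measure.isProbabilityMeasure_map (μ := ν) hT.aemeasurable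
    exact (Measure.pi_map_pi (μ := fun _ : Fin n => ν) (f := fun _ => T) fun _ => hT.aemeasurable).symm
  have hTm : Measurable (fun (d : Fin n → X) i => T (d i)) := by fun_prop
  have e0 : dataLaw n θ₀ F = Measure.pi (fun _ : Fin n => μ) ((fun d i => T (d i)) ⁻¹' F) := by
    unfold dataLaw
    rw [h₀, hmap μ inferInstance, Measure.map_apply hTm hF]
  have e1 : ∀ i, dataLaw n (θ i) F = (Measure.pi (fun _ : Fin n => μ)).withDensity
      (fun x => ∏ k, f i (x k)) ((fun d i => T (d i)) ⁻¹' F) := fun i => by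
    unfold dataLaw
    rw [hθ i, hmap _ inferInstance, Measure.map_apply hTm hF, pi_withDensity_prod μ (f i) (hf i)]
  rw [e0]
  simp_rw [e1]
  have : ∀ i, IsProbabilityMeasure ((Measure.pi (fun _ : Fin n => μ)).withDensity
      (fun x => ∏ k, f i (x k))) := fun i => by
    rw [← pi_withDensity_prod μ (f i) (hf i)]; infer_instance
  refine mixture_le_add _ _ (fun i => by fun_prop) ?_ (hTm hF)
  refine le_trans (le_of_eq ?_) h2
  refine Finset.sum_congr rfl fun i _ => Finset.sum_congr rfl fun j _ => ?_
  simp_rw [← Finset.prod_mul_distrib]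
  rw [lintegral_pi_prod μ (fun x => f i x * f j x) ((hf i).mul (hf j)), Fintype.card_fin]

/-! ### Gaussian integrals and likelihood ratios of a linear response -/

theorem lintegral_exp_quadratic {b : ℝ} (hb : 0 < b) (c d : ℝ) :
    ∫⁻ x : ℝ, ENNReal.ofReal (Real.exp (-b * x ^ 2 + c * x + d)) =
      ENNReal.ofReal (√(Real.pi / b) * Real.exp (d + c ^ 2 / (4 * b))) := by
  have h : ∀ x : ℝ, Real.exp (-b * x ^ 2 + c * x + d) =
      Real.exp (-b * (x - c / (2 * b)) ^ 2) * Real.exp (d + c ^ 2 / (4 * b)) := fun x => by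
    rw [← Real.exp_add]; congr 1; field_simp; ring
  simp_rw [h]
  rw [← ofReal_integral_eq_lintegral_ofReal, integral_mul_const,
    integral_sub_right_eq_self (fun x : ℝ => Real.exp (-b * x ^ 2)), integral_gaussian]
  · exact ((integrable_exp_neg_mul_sq hb).comp_sub_right (c / (2 * b))).mul_const _
  · exact Filter.Eventually.of_forall fun x => by positivity

theorem lintegral_gaussianReal {μ : ℝ} {v : NNReal} (hv : v ≠ 0) {f : ℝ → ENNReal}
    (hf : Measurable f) :
    ∫⁻ x, f x ∂(gaussianReal μ v) = ∫⁻ x, gaussianPDF μ v x * f x := by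
  rw [gaussianReal_of_var_ne_zero μ hv,
    lintegral_withDensity_eq_lintegral_mul _ (measurable_gaussianPDF μ v) hf]
  rfl

/-- The exponential moment of a quadratic polynomial of a standard normal variable. -/
theorem lintegral_exp_quadratic_gaussianReal {b : ℝ} (hb : b < 1 / 2) (c d : ℝ) :
    ∫⁻ x : ℝ, ENNReal.ofReal (Real.exp (b * x ^ 2 + c * x + d)) ∂(gaussianReal 0 1) =
      ENNReal.ofReal ((√(1 - 2 * b))⁻¹ * Real.exp (d + c ^ 2 / (2 * (1 - 2 * b)))) := by
  rw [lintegral_gaussianReal one_ne_zero (by fun_prop)]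
  have h : ∀ x : ℝ, gaussianPDF 0 1 x * ENNReal.ofReal (Real.exp (b * x ^ 2 + c * x + d)) =
      ENNReal.ofReal (√(2 * Real.pi))⁻¹ *
        ENNReal.ofReal (Real.exp (-((1 - 2 * b) / 2) * x ^ 2 + c * x + d)) := fun x => by
    rw [gaussianPDF, gaussianPDFReal, ← ENNReal.ofReal_mul (by positivity),
      ← ENNReal.ofReal_mul (by positivity), mul_assoc, ← Real.exp_add]
    congr 2
    · simp
    · congr 1; simp; ring
  have hb' : 0 < (1 - 2 * b) / 2 := by linarith
  simp_rw [h]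
  rw [lintegral_const_mul _ (by fun_prop), lintegral_exp_quadratic hb',
    ← ENNReal.ofReal_mul (by positivity), ← mul_assoc]
  congr 2
  · rw [← Real.sqrt_inv, ← Real.sqrt_mul (by positivity), ← Real.sqrt_inv]
    congr 1
    have : 1 - 2 * b ≠ 0 := by linarith
    field_simp
  · congr 3; ring

/-- The law of independent standard normal noise and regressors. -/
abbrev stdLaw (p : ℕ) : Measure (ℝ × (Fin p → ℝ)) :=
  (gaussianReal 0 1).prod (Measure.pi fun _ : Fin p => gaussianReal 0 1)

/-- Replace the noise `e` by the unit variance response `√(1 - ‖ω‖²) e + ⟨x, ω⟩`. -/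
def respond {p : ℕ} (ω : Fin p → ℝ) (z : ℝ × (Fin p → ℝ)) : ℝ × (Fin p → ℝ) :=
  (√(1 - ω ⬝ᵥ ω) * z.1 + z.2 ⬝ᵥ ω, z.2)

/-- The likelihood ratio of the response with coefficients `ω` against pure noise. -/
def likelihood {p : ℕ} (ω : Fin p → ℝ) (z : ℝ × (Fin p → ℝ)) : ENNReal :=
  ENNReal.ofReal ((√(1 - ω ⬝ᵥ ω))⁻¹ *
    Real.exp (-(z.1 - z.2 ⬝ᵥ ω) ^ 2 / (2 * (1 - ω ⬝ᵥ ω)) + z.1 ^ 2 / 2))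

theorem measurable_respond {p : ℕ} (ω : Fin p → ℝ) : Measurable (respond ω) := by
  unfold respond dotProduct; fun_prop

theorem measurable_likelihood {p : ℕ} (ω : Fin p → ℝ) : Measurable (likelihood ω) := by
  unfold likelihood dotProduct; fun_prop

/-- Given the regressors `x`, the response is `N(⟨x, ω⟩, 1 - ‖ω‖²)`, and `likelihood ω` is the
quotient of its density by the standard normal one. The law of the regressors is unchanged, so it
suffices to compare fibrewise. -/
theorem map_respond_eq_withDensity {p : ℕ} {ω : Fin p → ℝ} (hω : ω ⬝ᵥ ω < 1) :
    (stdLaw p).map (respond ω) = (stdLaw p).withDensity (likelihood ω) := by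
  refine Measure.ext_of_lintegral _ fun f hf => ?_
  rw [lintegral_map hf (measurable_respond ω),
    lintegral_withDensity_eq_lintegral_mul _ (measurable_likelihood ω) hf,
    lintegral_prod_symm (fun z => f (respond ω z)) ((hf.comp (measurable_respond ω)).aemeasurable),
    lintegral_prod_symm _ (((measurable_likelihood ω).mul hf).aemeasurable)]
  refine lintegral_congr fun x => ?_
  have hv : 0 < 1 - ω ⬝ᵥ ω := by linarith
  set v : NNReal := ⟨1 - ω ⬝ᵥ ω, hv.le⟩ with hvdef
  have hv0 : v ≠ 0 := fun h => hv.ne' (congrArg NNReal.toReal h)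
  have hfx : Measurable fun a : ℝ => f (a, x) := by fun_prop
  have e1 : ∫⁻ e, f (respond ω (e, x)) ∂(gaussianReal 0 1) =
      ∫⁻ a, f (a, x) ∂(gaussianReal (x ⬝ᵥ ω) v) := by
    have : (gaussianReal 0 1).map (fun e => √(1 - ω ⬝ᵥ ω) * e + x ⬝ᵥ ω) =
        gaussianReal (x ⬝ᵥ ω) v := by
      have h := gaussianReal_map_add_const (μ := 0) (v := v) (x ⬝ᵥ ω)
      rw [zero_add] at h
      rw [← h]
      have h' := gaussianReal_map_const_mul (μ := 0) (v := 1) (√(1 - ω ⬝ᵥ ω))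
      have h3 : (gaussianReal 0 1).map (fun e => √(1 - ω ⬝ᵥ ω) * e) = gaussianReal 0 v := by
        refine h'.trans ?_
        congr 1
        · simp
        · rw [mul_one]; ext; simp [Real.sq_sqrt hv.le]; rfl
      rw [← h3, Measure.map_map (by fun_prop) (by fun_prop)]
      rfl
    rw [← this, lintegral_map hfx (by fun_prop)]
    rfl
  rw [e1, lintegral_gaussianReal hv0 hfx, lintegral_gaussianReal one_ne_zero
    (f := fun a => (likelihood ω * f) (a, x))
    (((measurable_likelihood ω).mul hf).comp measurable_prodMk_right)]
  refine lintegral_congr fun a => ?_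
  simp only [Pi.mul_apply]
  rw [← mul_assoc]
  congr 1
  rw [likelihood, gaussianPDF, gaussianPDF, gaussianPDFReal, gaussianPDFReal,
    ← ENNReal.ofReal_mul (by positivity)]
  congr 1
  rw [mul_mul_mul_comm, ← Real.exp_add, ← mul_inv]
  have : (v : ℝ) = 1 - ω ⬝ᵥ ω := rfl
  rw [this]
  congr 2
  · rw [← Real.sqrt_mul (by positivity)]; simp
  · simp; ring

/-- The characteristic function of a linear image of the standard normal law. -/
theorem charFunDual_map_stdLaw {p : ℕ} {F : Type*} [NormedAddCommGroup F] [NormedSpace ℝ F]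
    [MeasurableSpace F] [BorelSpace F] {f : ℝ × (Fin p → ℝ) → F} (hf : IsLinearMap ℝ f)
    (ℓ : StrongDual ℝ F) :
    charFunDual ((stdLaw p).map f) ℓ =
      Complex.exp (((-(ℓ (f (1, 0)) ^ 2 + ∑ i, ℓ (f (0, Pi.single i 1)) ^ 2) / 2 : ℝ) : ℂ)) := by
  set g : ℝ × (Fin p → ℝ) →L[ℝ] F := LinearMap.toContinuousLinearMap (hf.mk' f) with hg
  have hfg : f = g := rfl
  have h1 : ∀ L : StrongDual ℝ ℝ, charFunDual (gaussianReal 0 1) L =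
      Complex.exp (((-(L 1) ^ 2 / 2 : ℝ) : ℂ)) := fun L => by
    rw [← charFun_toDual_symm_eq_charFunDual, charFun_gaussianReal]
    have : (InnerProductSpace.toDual ℝ ℝ).symm L = L 1 := by
      have := InnerProductSpace.toDual_symm_apply (𝕜 := ℝ) (x := (1 : ℝ)) (y := L)
      simpa using this
    rw [this]; congr 1; push_cast; simp; ring
  rw [hfg, charFunDual_map, charFunDual_prod, charFunDual_pi]
  simp_rw [h1]
  rw [← Complex.exp_sum, ← Complex.exp_add, ← Complex.ofReal_sum, ← Complex.ofReal_add]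
  congr 2
  simp only [ContinuousLinearMap.comp_apply, ContinuousLinearMap.inl_apply,
    ContinuousLinearMap.inr_apply, ContinuousLinearMap.single_apply]
  rw [neg_add, add_div, ← Finset.sum_div, ← Finset.sum_neg_distrib]

theorem sq_dotProduct_le_and_lt_one {p : ℕ} {ω η : Fin p → ℝ} (hω : ω ⬝ᵥ ω < 1) (hη : η ⬝ᵥ η < 1) :
    (ω ⬝ᵥ η) ^ 2 ≤ (ω ⬝ᵥ ω) * (η ⬝ᵥ η) ∧ (ω ⬝ᵥ η) ^ 2 < 1 := by
  have h : (ω ⬝ᵥ η) ^ 2 ≤ (ω ⬝ᵥ ω) * (η ⬝ᵥ η) := by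
    simpa [dotProduct, sq] using Finset.sum_mul_sq_le_sq_mul_sq Finset.univ ω η
  have h0 : 0 ≤ ω ⬝ᵥ ω := Finset.sum_nonneg fun i _ => mul_self_nonneg _
  have h1 : 0 ≤ η ⬝ᵥ η := Finset.sum_nonneg fun i _ => mul_self_nonneg _
  exact ⟨h, by nlinarith⟩

/-- The ratio `likelihood η` depends on the data only through the response and `⟨x, η⟩`. Under `ω`
this pair is centred Gaussian with variances `1`, `‖η‖²` and covariance `⟨ω, η⟩`; the right side
realizes it with two independent normals, which reduces the second moment to one-dimensional
integrals. -/
theorem map_respond_dotProduct {p : ℕ} {ω η : Fin p → ℝ} (hω : ω ⬝ᵥ ω < 1) (hη : η ⬝ᵥ η < 1) :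
    (stdLaw p).map (fun z => ((respond ω z).1, z.2 ⬝ᵥ η)) =
      (stdLaw 1).map (fun z => (z.1, (ω ⬝ᵥ η) * z.1 + √(η ⬝ᵥ η - (ω ⬝ᵥ η) ^ 2) * z.2 0)) := by
  have hs : 0 ≤ η ⬝ᵥ η - (ω ⬝ᵥ η) ^ 2 := by
    have h1 : 0 ≤ η ⬝ᵥ η := Finset.sum_nonneg fun i _ => mul_self_nonneg _
    nlinarith [(sq_dotProduct_le_and_lt_one hω hη).1]
  have m1 : Measurable (fun z : ℝ × (Fin p → ℝ) => ((respond ω z).1, z.2 ⬝ᵥ η)) := by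
    unfold respond dotProduct; fun_prop
  have := Measure.isProbabilityMeasure_map (μ := stdLaw p) m1.aemeasurable
  have m2 : Measurable (fun z : ℝ × (Fin 1 → ℝ) =>
    (z.1, (ω ⬝ᵥ η) * z.1 + √(η ⬝ᵥ η - (ω ⬝ᵥ η) ^ 2) * z.2 0)) := by fun_prop
  have := Measure.isProbabilityMeasure_map (μ := stdLaw 1) m2.aemeasurable
  refine Measure.ext_of_charFunDual (funext fun ℓ => ?_)
  obtain ⟨α, β, hl⟩ : ∃ α β, ∀ a b : ℝ, ℓ (a, b) = a * α + b * β := by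
    refine ⟨ℓ (1, 0), ℓ (0, 1), fun a b => ?_⟩
    have : ((a, b) : ℝ × ℝ) = a • (1, 0) + b • (0, 1) := by simp
    rw [this, map_add, map_smul, map_smul]; rfl
  rw [charFunDual_map_stdLaw, charFunDual_map_stdLaw]
  · congr 2
    simp only [respond, hl]
    simp only [zero_dotProduct, single_one_dotProduct, mul_zero, mul_one, zero_add, add_zero,
      Finset.univ_unique, Fin.default_eq_zero, Finset.sum_singleton, Pi.zero_apply, zero_mul,
      Pi.single_eq_same, one_mul]
    have e : ∑ i, (ω i * α + η i * β) ^ 2 = (ω ⬝ᵥ ω) * α ^ 2 +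
        2 * (ω ⬝ᵥ η) * α * β + (η ⬝ᵥ η) * β ^ 2 := by
      simp only [dotProduct, Finset.sum_mul, Finset.mul_sum, ← Finset.sum_add_distrib]
      exact Finset.sum_congr rfl fun i _ => by ring
    rw [e, mul_pow, mul_pow, Real.sq_sqrt (by linarith), Real.sq_sqrt hs]
    ring
  · constructor <;> intros <;> ext <;> simp <;> ring_nf
  · constructor <;> intros <;> ext <;> simp [respond, add_dotProduct, smul_dotProduct] <;> ring_nf

/-- The second moment of the likelihood ratios. -/
theorem lintegral_likelihood_mul {p : ℕ} {ω η : Fin p → ℝ} (hω : ω ⬝ᵥ ω < 1) (hη : η ⬝ᵥ η < 1) :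
    ∫⁻ z, likelihood ω z * likelihood η z ∂(stdLaw p) = ENNReal.ofReal (1 - ω ⬝ᵥ η)⁻¹ := by
  -- One of the two ratios is absorbed as a change of measure, leaving the expectation of the other
  -- under `ω`.
  have h1 : ∫⁻ z, likelihood ω z * likelihood η z ∂(stdLaw p) =
      ∫⁻ z, likelihood η z ∂((stdLaw p).withDensity (likelihood ω)) :=
    (lintegral_withDensity_eq_lintegral_mul _ (measurable_likelihood ω)
      (measurable_likelihood η)).symm
  set v := 1 - η ⬝ᵥ η with hv
  set j := ω ⬝ᵥ η with hj
  set K : ℝ × ℝ → ENNReal := fun y => ENNReal.ofReal ((√v)⁻¹ *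
    Real.exp (-(y.1 - y.2) ^ 2 / (2 * v) + y.1 ^ 2 / 2)) with hK
  have hKm : Measurable K := by fun_prop
  have hv0 : 0 < v := by linarith
  obtain ⟨hcs, hj1⟩ := sq_dotProduct_le_and_lt_one hω hη
  have hja : -1 < j ∧ j < 1 := abs_lt.1 ((sq_lt_one_iff_abs_lt_one _).1 hj1)
  have hs : 0 ≤ η ⬝ᵥ η - j ^ 2 := by
    have h1 : 0 ≤ η ⬝ᵥ η := Finset.sum_nonneg fun i _ => mul_self_nonneg _
    nlinarith
  set s := √(η ⬝ᵥ η - j ^ 2) with hsdef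
  have hs2 : s ^ 2 = 1 - v - j ^ 2 := by rw [hsdef, Real.sq_sqrt hs]; ring
  have m1 : Measurable (fun z : ℝ × (Fin p → ℝ) => ((respond ω z).1, z.2 ⬝ᵥ η)) := by
    unfold respond dotProduct; fun_prop
  have h2 : ∫⁻ z, likelihood η z ∂((stdLaw p).withDensity (likelihood ω)) =
      ∫⁻ y, K y ∂((stdLaw p).map (fun z => ((respond ω z).1, z.2 ⬝ᵥ η))) := by
    rw [← map_respond_eq_withDensity hω, lintegral_map (measurable_likelihood η)
      (measurable_respond ω), lintegral_map hKm m1]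
    rfl
  have hjj : 0 < 1 - j ^ 2 := by linarith
  rw [h1, h2, map_respond_dotProduct hω hη, lintegral_map hKm (by fun_prop),
    lintegral_prod _ (by fun_prop)]
  -- Integrating out the second normal leaves a factor `exp(j a² / (1 + j))`; the remaining integral
  -- contributes `√((1 + j)/(1 - j))`, and the product with `(1 - j²)^{-1/2}` is `1/(1 - j)`.
  have h3 : ∀ a : ℝ, ∫⁻ x : Fin 1 → ℝ, K (a, j * a + s * x 0)
      ∂(Measure.pi fun _ : Fin 1 => gaussianReal 0 1) =
      ENNReal.ofReal (√(1 - j ^ 2))⁻¹ *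
        ENNReal.ofReal (Real.exp ((j / (1 + j)) * a ^ 2 + 0 * a + 0)) := fun a => by
    have e := (measurePreserving_eval (fun _ : Fin 1 => gaussianReal 0 1) 0).lintegral_comp
      (f := fun g => K (a, j * a + s * g)) (by fun_prop)
    refine e.trans ?_
    have e2 : ∀ g : ℝ, K (a, j * a + s * g) = ENNReal.ofReal (√v)⁻¹ *
        ENNReal.ofReal (Real.exp ((-s ^ 2 / (2 * v)) * g ^ 2 + (a * (1 - j) * s / v) * g +
          (-(a * (1 - j)) ^ 2 / (2 * v) + a ^ 2 / 2))) := fun g => by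
      rw [hK, ← ENNReal.ofReal_mul (by positivity)]
      field_simp; ring_nf
    simp_rw [e2]
    have hb : -s ^ 2 / (2 * v) < 1 / 2 := by
      have : -s ^ 2 / (2 * v) ≤ 0 := by
        rw [neg_div]; exact neg_nonpos.2 (by positivity)
      linarith
    have e3 : 1 - 2 * (-s ^ 2 / (2 * v)) = (1 - j ^ 2) / v := by
      rw [hs2]; field_simp; ring
    rw [lintegral_const_mul _ (by fun_prop), lintegral_exp_quadratic_gaussianReal hb, e3,
      ← ENNReal.ofReal_mul (by positivity), ← ENNReal.ofReal_mul (by positivity), ← mul_assoc]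
    congr 2
    · rw [← mul_inv, ← Real.sqrt_mul hv0.le]; congr 2; field_simp
    · congr 1
      have : (a * (1 - j) * s / v) ^ 2 = (a * (1 - j)) ^ 2 * (1 - v - j ^ 2) / v ^ 2 := by
        rw [← hs2]; ring
      rw [this]
      have h1j : 1 + j ≠ 0 := by linarith
      have h1j' : 1 - j ≠ 0 := by linarith
      have : 1 - j ^ 2 = (1 + j) * (1 - j) := by ring
      rw [this]
      field_simp
      ring
  refine (lintegral_congr h3).trans ?_
  have hb : j / (1 + j) < 1 / 2 := by
    rw [div_lt_div_iff₀ (by linarith) (by norm_num)]; linarith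
  rw [lintegral_const_mul _ (by fun_prop), lintegral_exp_quadratic_gaussianReal hb,
    ← ENNReal.ofReal_mul (by positivity)]
  congr 1
  have h1j : 1 + j ≠ 0 := by linarith
  simp only [ne_eq, OfNat.ofNat_ne_zero, not_false_eq_true, zero_pow, zero_div, add_zero,
    Real.exp_zero, mul_one]
  rw [← mul_inv, ← Real.sqrt_mul hjj.le]
  congr 1
  rw [Real.sqrt_eq_iff_mul_self_eq (by
    have : 1 - 2 * (j / (1 + j)) > 0 := by linarith
    positivity) (by linarith)]
  field_simp
  ring

theorem isProbabilityMeasure_withDensity_likelihood {p : ℕ} {ω : Fin p → ℝ} (hω : ω ⬝ᵥ ω < 1) :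
    IsProbabilityMeasure ((stdLaw p).withDensity (likelihood ω)) := by
  rw [← map_respond_eq_withDensity hω]
  exact Measure.isProbabilityMeasure_map (measurable_respond ω).aemeasurable

/-! ### Bordered covariance matrices and membership in the parameter space -/

/-- The covariance matrix of `(Z, W)` when both have unit variances, `W` has independent
coordinates, and `Z` has covariance `v` with `W`. -/
def borderedCov {q : ℕ} (v : Fin q → ℝ) : Matrix (Fin (q + 1)) (Fin (q + 1)) ℝ :=
  Matrix.of (Fin.cons (Fin.cons 1 v) fun i => Fin.cons (v i) ((1 : Matrix (Fin q) (Fin q) ℝ) i))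

section borderedCov

variable {q : ℕ} (v : Fin q → ℝ)

@[simp] theorem borderedCov_zero_zero : borderedCov v 0 0 = 1 := rfl
@[simp] theorem borderedCov_zero_succ (j : Fin q) : borderedCov v 0 j.succ = v j := rfl
@[simp] theorem borderedCov_succ_zero (i : Fin q) : borderedCov v i.succ 0 = v i := rfl
@[simp] theorem borderedCov_succ_succ (i j : Fin q) :
    borderedCov v i.succ j.succ = (1 : Matrix (Fin q) (Fin q) ℝ) i j := rfl

theorem borderedCov_submatrix : (borderedCov v).submatrix Fin.succ Fin.succ = 1 := by
  ext i j; rfl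

theorem isHermitian_borderedCov : (borderedCov v).IsHermitian := by
  ext i j
  cases i using Fin.cases <;> cases j using Fin.cases <;>
    simp [Matrix.conjTranspose_apply, Matrix.one_apply, eq_comm]

theorem borderedCov_mulVec_zero (x : Fin (q + 1) → ℝ) :
    (borderedCov v).mulVec x 0 = x 0 + v ⬝ᵥ (fun j => x j.succ) := by
  simp [Matrix.mulVec, dotProduct, Fin.sum_univ_succ]

theorem borderedCov_mulVec_succ (x : Fin (q + 1) → ℝ) (i : Fin q) :
    (borderedCov v).mulVec x i.succ = v i * x 0 + x i.succ := by
  simp [Matrix.mulVec, dotProduct, Fin.sum_univ_succ, Matrix.one_apply]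

theorem dotProduct_borderedCov_mulVec (x : Fin (q + 1) → ℝ) :
    x ⬝ᵥ (borderedCov v).mulVec x = x 0 ^ 2 + 2 * x 0 * (v ⬝ᵥ fun j => x j.succ) +
      (fun j => x j.succ) ⬝ᵥ fun j : Fin q => x j.succ := by
  rw [dotProduct, Fin.sum_univ_succ, borderedCov_mulVec_zero]
  simp_rw [borderedCov_mulVec_succ]
  have : ∑ i : Fin q, x i.succ * (v i * x 0 + x i.succ) =
      x 0 * (v ⬝ᵥ fun j => x j.succ) + (fun j => x j.succ) ⬝ᵥ fun j : Fin q => x j.succ := by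
    simp only [dotProduct, Finset.mul_sum, ← Finset.sum_add_distrib]
    exact Finset.sum_congr rfl fun i _ => by ring
  rw [this]; ring

variable {v}

theorem posDef_borderedCov (hv : v ⬝ᵥ v < 1) : (borderedCov v).PosDef := by
  refine Matrix.PosDef.of_dotProduct_mulVec_pos (isHermitian_borderedCov v) fun x hx => ?_
  rw [star_trivial, dotProduct_borderedCov_mulVec]
  set w := fun j : Fin q => x j.succ with hw
  have e : x 0 ^ 2 + 2 * x 0 * (v ⬝ᵥ w) + w ⬝ᵥ w =
      (1 - v ⬝ᵥ v) * x 0 ^ 2 + (w + x 0 • v) ⬝ᵥ (w + x 0 • v) := by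
    simp only [add_dotProduct, dotProduct_add, smul_dotProduct, dotProduct_smul, smul_eq_mul,
      dotProduct_comm w v]
    ring
  rw [e]
  have h1 : 0 ≤ (w + x 0 • v) ⬝ᵥ (w + x 0 • v) := Finset.sum_nonneg fun i _ => mul_self_nonneg _
  have h2 : 0 < 1 - v ⬝ᵥ v := by linarith
  by_cases h0 : x 0 = 0
  · rw [h0, zero_smul, add_zero]
    have hw0 : w ≠ 0 := fun h => hx (by
      ext i
      cases i using Fin.cases with
      | zero => exact h0
      | succ i => exact congrFun h i)
    have : w ⬝ᵥ w ≠ 0 := fun h => hw0 (dotProduct_self_eq_zero.1 h)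
    have h3 : 0 ≤ w ⬝ᵥ w := Finset.sum_nonneg fun i _ => mul_self_nonneg _
    have := lt_of_le_of_ne h3 this.symm
    simpa using this
  · have : 0 < x 0 ^ 2 := by positivity
    positivity

/-- The row is a multiple of `(1, -v)`, so its sparsity is that of `v` plus one. The identity is
checked by multiplying this vector by the matrix. -/
theorem borderedCov_inv_zero (hv : v ⬝ᵥ v < 1) :
    (borderedCov v)⁻¹ 0 = (1 - v ⬝ᵥ v)⁻¹ • (Fin.cons 1 (-v) : Fin (q + 1) → ℝ) := by
  have hu : 1 - v ⬝ᵥ v ≠ 0 := by linarith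
  have hdet : IsUnit (borderedCov v).det := (posDef_borderedCov hv).det_pos.ne'.isUnit
  have h : Matrix.vecMul ((1 - v ⬝ᵥ v)⁻¹ • (Fin.cons 1 (-v) : Fin (q + 1) → ℝ)) (borderedCov v) =
      Pi.single 0 1 := by
    have hT : (borderedCov v).transpose = borderedCov v := by
      simpa [Matrix.IsHermitian, Matrix.conjTranspose_eq_transpose_of_trivial] using
        isHermitian_borderedCov v
    rw [← Matrix.mulVec_transpose, hT]
    ext i
    cases i using Fin.cases with
    | zero =>
      rw [borderedCov_mulVec_zero]
      have : (fun j : Fin q => ((1 - v ⬝ᵥ v)⁻¹ • (Fin.cons 1 (-v) : Fin (q + 1) → ℝ)) j.succ) =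
          -((1 - v ⬝ᵥ v)⁻¹ • v) := by ext j; simp
      rw [this, dotProduct_neg, dotProduct_smul]
      simp; field_simp; ring
    | succ i =>
      rw [borderedCov_mulVec_succ]
      simp; ring
  have h2 := congrArg (fun y => Matrix.vecMul y (borderedCov v)⁻¹) h
  simp only [Matrix.vecMul_vecMul, Matrix.mul_nonsing_inv _ hdet, Matrix.vecMul_one] at h2
  rw [h2]
  ext j; simp

/-- Minus the identity, the matrix has rank at most two, with `v` on its border. An eigenvector with
`x 0 = 0` forces eigenvalue `1`; otherwise eliminating the other coordinates gives `(lam - 1)² =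
‖v‖²`. -/
theorem sq_eigenvalues_borderedCov_sub_one_le (i : Fin (q + 1)) :
    ((isHermitian_borderedCov v).eigenvalues i - 1) ^ 2 ≤ v ⬝ᵥ v := by
  set lam := (isHermitian_borderedCov v).eigenvalues i
  have hu : 0 ≤ v ⬝ᵥ v := Finset.sum_nonneg fun i _ => mul_self_nonneg _
  have he := (isHermitian_borderedCov v).mulVec_eigenvectorBasis i
  have hne : (isHermitian_borderedCov v).eigenvectorBasis i ≠ 0 :=
    (isHermitian_borderedCov v).eigenvectorBasis.orthonormal.ne_zero i
  set x : Fin (q + 1) → ℝ := ⇑((isHermitian_borderedCov v).eigenvectorBasis i) with hx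
  have h0 : x 0 + v ⬝ᵥ (fun j => x j.succ) = lam * x 0 := by
    rw [← borderedCov_mulVec_zero, he]; rfl
  have h1 : ∀ j : Fin q, v j * x 0 + x j.succ = lam * x j.succ := fun j => by
    rw [← borderedCov_mulVec_succ, he]; rfl
  have h2 : ∀ j : Fin q, (lam - 1) * x j.succ = v j * x 0 := fun j => by linarith [h1 j]
  by_cases hx0 : x 0 = 0
  · have : ∃ j : Fin q, x j.succ ≠ 0 := by
      by_contra! hall
      refine hne ?_
      ext k
      cases k using Fin.cases with
      | zero => exact hx0
      | succ k => exact hall k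
    obtain ⟨j, hj⟩ := this
    have := h2 j
    rw [hx0, mul_zero, mul_eq_zero] at this
    rw [this.resolve_right hj]; simpa using hu
  · have h3 : (lam - 1) * (v ⬝ᵥ fun j => x j.succ) = (v ⬝ᵥ v) * x 0 := by
      simp only [dotProduct, Finset.mul_sum, Finset.sum_mul]
      exact Finset.sum_congr rfl fun j _ => by
        rw [mul_left_comm, h2 j]; ring
    have h4 : v ⬝ᵥ (fun j => x j.succ) = (lam - 1) * x 0 := by linarith
    rw [h4, ← mul_assoc, ← sq] at h3
    exact (mul_right_cancel₀ hx0 h3).le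

end borderedCov

theorem norm_sq_coeff {q : ℕ} (θ : Param q) : ‖θ.coeff‖ ^ 2 = θ.β ^ 2 + θ.γ ⬝ᵥ θ.γ := by
  rw [EuclideanSpace.real_norm_sq_eq, Fin.sum_univ_succ]
  simp [Param.coeff, dotProduct, sq]

theorem hammingNorm_precisionRow_le {q s k : ℕ} {θ : Param q} {v : Fin q → ℝ}
    (hcov : θ.cov = borderedCov v) (hv : v ⬝ᵥ v < 1) (hk : hammingNorm v ≤ k) (hs : k + 1 ≤ s) :
    hammingNorm θ.precisionRow ≤ s := by
  refine le_trans ?_ hs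
  have : θ.precisionRow = (1 - v ⬝ᵥ v)⁻¹ • (Fin.cons 1 (-v) : Fin (q + 1) → ℝ) := by
    rw [← borderedCov_inv_zero hv, ← hcov]; rfl
  rw [this]
  unfold hammingNorm at *
  have hsub : (Finset.univ.filter fun i =>
      ((1 - v ⬝ᵥ v)⁻¹ • (Fin.cons 1 (-v) : Fin (q + 1) → ℝ)) i ≠ 0) ⊆
      insert 0 ((Finset.univ.filter fun i => v i ≠ 0).image Fin.succ) := by
    intro i hi
    cases i using Fin.cases with
    | zero => simp
    | succ i =>
      simp only [Finset.mem_filter, Finset.mem_univ, true_and, Pi.smul_apply, Fin.cons_succ,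
        Pi.neg_apply, neg_ne_zero, smul_ne_zero_iff] at hi
      refine Finset.mem_insert_of_mem (Finset.mem_image_of_mem _ ?_)
      simpa using hi.2
  refine (Finset.card_le_card hsub).trans ((Finset.card_insert_le _ _).trans ?_)
  exact Nat.add_le_add_right (Finset.card_image_le.trans hk) 1

/-- Membership in the parameter space for bordered covariance matrices. -/
theorem mem_theta_of_borderedCov {M M₁ M₂ : ℝ} (hM : 1 < M) (hM₂ : 0 ≤ M₂) {q s k : ℕ}
    {θ : Param q} {v : Fin q → ℝ} (hcov : θ.cov = borderedCov v)
    (hv : v ⬝ᵥ v ≤ (1 - M⁻¹) ^ 2) (hk : hammingNorm v ≤ k) (hs : k + 1 ≤ s)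
    (hσ : 0 ≤ θ.σ) (hσ' : θ.σ ≤ M₁) (hc : θ.β ^ 2 + θ.γ ⬝ᵥ θ.γ ≤ M₂ ^ 2) :
    θ ∈ theta M M₁ M₂ q s := by
  have hMi : 0 < M⁻¹ := by positivity
  have hMi1 : M⁻¹ < 1 := inv_lt_one_of_one_lt₀ hM
  have hMM : M * M⁻¹ = 1 := mul_inv_cancel₀ (by linarith)
  refine ⟨⟨⟨⟨hcov ▸ isHermitian_borderedCov v, fun i => ?_⟩, hσ, hσ', ?_⟩, ?_⟩, ?_⟩
  · have h : ∀ (A : Matrix (Fin (q + 1)) (Fin (q + 1)) ℝ) (hA : A.IsHermitian),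
        A = borderedCov v → M⁻¹ ≤ hA.eigenvalues i ∧ hA.eigenvalues i ≤ M := by
      rintro A hA rfl
      have := abs_le_of_sq_le_sq' ((sq_eigenvalues_borderedCov_sub_one_le i).trans hv)
        (by linarith)
      -- The upper bound obtained is `2 - M⁻¹`, which is at most `M` because `M + M⁻¹ ≥ 2`.
      exact ⟨by linarith [this.1], by nlinarith [this.2]⟩
    exact h _ _ hcov
  · exact abs_le_of_sq_le_sq' (by rw [norm_sq_coeff]; exact hc) hM₂ |>.2
  · rw [hcov]; exact borderedCov_submatrix v
  · exact hammingNorm_precisionRow_le hcov (by nlinarith) hk hs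

/-! ### Characteristic function of one observation -/

theorem charFunDual_multivariateGaussian_zero {ι : Type*} [Fintype ι] [DecidableEq ι]
    {S : Matrix ι ι ℝ} (hS : S.PosSemidef) (L : StrongDual ℝ (EuclideanSpace ℝ ι)) :
    charFunDual (multivariateGaussian 0 S) L = Complex.exp ((-((fun i =>
      L (EuclideanSpace.single i 1)) ⬝ᵥ S.mulVec fun i => L (EuclideanSpace.single i 1)) / 2 : ℝ) : ℂ) := by
  rw [← charFun_toDual_symm_eq_charFunDual, charFun_multivariateGaussian hS]
  have : ((InnerProductSpace.toDual ℝ (EuclideanSpace ℝ ι)).symm L).ofLp =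
      fun i => L (EuclideanSpace.single i 1) := by
    ext i
    rw [← InnerProductSpace.toDual_symm_apply (𝕜 := ℝ) (y := L), EuclideanSpace.inner_single_right]
    simp
  rw [this]
  congr 1
  push_cast
  simp
  ring

/-- The characteristic function of the law of one observation with a bordered covariance matrix. -/
theorem charFunDual_obsLaw {q : ℕ} {θ : Param q} {v : Fin q → ℝ} (hcov : θ.cov = borderedCov v)
    (hv : v ⬝ᵥ v < 1) (ℓ : StrongDual ℝ (Obs q)) {a b : ℝ} {w : Fin q → ℝ}
    (hl : ∀ (y z : ℝ) (x : Fin q → ℝ), ℓ (y, z, x) = y * a + z * b + x ⬝ᵥ w) :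
    charFunDual (obsLaw θ) ℓ = Complex.exp ((-((θ.β * a + b) ^ 2 +
      2 * (θ.β * a + b) * (v ⬝ᵥ (a • θ.γ + w)) + (a • θ.γ + w) ⬝ᵥ (a • θ.γ + w) +
      θ.σ ^ 2 * a ^ 2) / 2 : ℝ) : ℂ) := by
  set f : EuclideanSpace ℝ (Fin (q + 1)) × ℝ → Obs q := fun w =>
    (w.1 0 * θ.β + ∑ j : Fin q, w.1 j.succ * θ.γ j + w.2, w.1 0, fun j : Fin q => w.1 j.succ) with hf
  have hlin : IsLinearMap ℝ f := by
    constructor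
    · intro x y
      ext <;> simp [hf, add_mul, Finset.sum_add_distrib]
      ring
    · intro c x
      ext <;> simp [hf, mul_add, Finset.mul_sum, mul_assoc]
  set g : EuclideanSpace ℝ (Fin (q + 1)) × ℝ →L[ℝ] Obs q :=
    LinearMap.toContinuousLinearMap (hlin.mk' f) with hg
  have hfg : f = g := rfl
  have hone : ∀ L : StrongDual ℝ ℝ, charFunDual (gaussianReal 0 (Real.toNNReal (θ.σ ^ 2))) L =
      Complex.exp (((-(θ.σ ^ 2 * (L 1) ^ 2) / 2 : ℝ) : ℂ)) := fun L => by
    rw [← charFun_toDual_symm_eq_charFunDual, charFun_gaussianReal]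
    have : (InnerProductSpace.toDual ℝ ℝ).symm L = L 1 := by
      have := InnerProductSpace.toDual_symm_apply (𝕜 := ℝ) (x := (1 : ℝ)) (y := L)
      simpa using this
    rw [this, Real.coe_toNNReal _ (sq_nonneg _)]; congr 1; push_cast; simp; ring
  have hS : θ.cov.PosSemidef := hcov ▸ (posDef_borderedCov hv).posSemidef
  unfold obsLaw
  rw [← hf, hfg, charFunDual_map, charFunDual_prod, charFunDual_multivariateGaussian_zero hS, hone,
    ← Complex.exp_add, ← Complex.ofReal_add, hcov, dotProduct_borderedCov_mulVec]
  have e0 : ℓ (g (EuclideanSpace.single 0 1, 0)) = θ.β * a + b := by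
    rw [← hfg]; simp [hf, hl, dotProduct]
  have e1 : ∀ j : Fin q, ℓ (g (EuclideanSpace.single j.succ 1, 0)) = (a • θ.γ + w) j := fun j => by
    rw [← hfg]
    simp only [hf, hl]
    simp [dotProduct, Fin.succ_ne_zero]
    ring
  have e2 : ℓ (g (0, 1)) = a := by
    rw [← hfg]; simp [hf, hl, dotProduct]
  simp only [ContinuousLinearMap.comp_apply, ContinuousLinearMap.inl_apply,
    ContinuousLinearMap.inr_apply, e0, e1, e2]
  congr 2
  ring

theorem exists_dual_obs_eq {q : ℕ} (ℓ : StrongDual ℝ (Obs q)) : ∃ (a b : ℝ) (w : Fin q → ℝ),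
    ∀ (y z : ℝ) (x : Fin q → ℝ), ℓ (y, z, x) = y * a + z * b + x ⬝ᵥ w := by
  refine ⟨ℓ (1, 0, 0), ℓ (0, 1, 0), fun j => ℓ (0, 0, Pi.single j 1), fun y z x => ?_⟩
  have : ((y, z, x) : Obs q) = y • (1, 0, 0) + z • (0, 1, 0) +
      ∑ j, x j • (0, 0, Pi.single j 1) := by
    ext
    · simp [Prod.fst_sum]
    · simp [Prod.fst_sum, Prod.snd_sum]
    · simp [Prod.snd_sum, Finset.sum_apply, Pi.single_apply]
  rw [this, map_add, map_add, map_smul, map_smul, map_sum]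
  simp_rw [map_smul]
  rfl

/-! ### The two families of parameters in standardized coordinates -/

/-- The observation read off from a standardized response and regressors by a rotation of the
response and the first regressor. -/
def rotatedObs {q : ℕ} (τ : ℝ) (z : ℝ × (Fin (q + 1) → ℝ)) : Obs q :=
  (τ * ((√2)⁻¹ * (z.1 + z.2 0)), (√2)⁻¹ * (z.1 - z.2 0), fun j => z.2 j.succ)

/-- The observation read off from a standardized response and regressors. -/
def scaledObs {q : ℕ} (τ : ℝ) (z : ℝ × (Fin (q + 1) → ℝ)) : Obs q :=
  (τ * z.1, z.2 0, fun j => z.2 j.succ)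

theorem measurable_rotatedObs {q : ℕ} (τ : ℝ) : Measurable (rotatedObs (q := q) τ) := by
  unfold rotatedObs; fun_prop

theorem measurable_scaledObs {q : ℕ} (τ : ℝ) : Measurable (scaledObs (q := q) τ) := by
  unfold scaledObs; fun_prop

/-- A parameter for which `Z` is confounded with `W` along the direction `v`. -/
def confoundedParam {q : ℕ} (τ : ℝ) (v : Fin q → ℝ) : Param q where
  β := -(τ * (v ⬝ᵥ v) / (1 - v ⬝ᵥ v))
  γ := (τ / (1 - v ⬝ᵥ v)) • v
  cov := borderedCov v
  σ := τ * √((1 - 2 * (v ⬝ᵥ v)) / (1 - v ⬝ᵥ v))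

/-- A parameter with independent regressors and no effect of `W`. -/
def simpleParam (q : ℕ) (τ b : ℝ) : Param q where
  β := τ * b
  γ := 0
  cov := borderedCov 0
  σ := τ * √(1 - b ^ 2)

/-- The regression coefficients of the rotated response under `confoundedParam τ v`. -/
def rotatedCoeff {q : ℕ} (v : Fin q → ℝ) : Fin (q + 1) → ℝ := Fin.cons 0 (√2 • v)

theorem rotatedCoeff_dotProduct {q : ℕ} (v w : Fin q → ℝ) :
    rotatedCoeff v ⬝ᵥ rotatedCoeff w = 2 * (v ⬝ᵥ w) := by
  simp only [rotatedCoeff, dotProduct, Fin.sum_univ_succ, Fin.cons_zero, Fin.cons_succ,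
    Finset.mul_sum, zero_mul, zero_add, Pi.smul_apply, smul_eq_mul]
  refine Finset.sum_congr rfl fun i _ => ?_
  rw [mul_mul_mul_comm, Real.mul_self_sqrt (by norm_num)]

/-- Both sides are centred Gaussian, so only covariances matter: `Var y = τ²`, `Cov(y, Z) = 0`,
`Cov(y, W) = τ v`, `Cov(Z, W) = v`. Solving these equations for the regression of `y` on `(Z, W)`
yields the values of `β`, `γ`, `σ` in `confoundedParam`. The bound `‖v‖² < 1/2` keeps the residual
variance `1 - 2‖v‖²` of the rotated response positive. -/
theorem obsLaw_confoundedParam {q : ℕ} (τ : ℝ) {v : Fin q → ℝ} (hv : v ⬝ᵥ v < 1 / 2) :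
    obsLaw (confoundedParam τ v) =
      ((stdLaw (q + 1)).map (respond (rotatedCoeff v))).map (rotatedObs τ) := by
  have := isProbabilityMeasure_obsLaw (confoundedParam τ v)
  have := Measure.isProbabilityMeasure_map (μ := stdLaw (q + 1))
    (measurable_respond (rotatedCoeff v)).aemeasurable
  have := Measure.isProbabilityMeasure_map
    (μ := (stdLaw (q + 1)).map (respond (rotatedCoeff v))) (measurable_rotatedObs τ).aemeasurable
  refine Measure.ext_of_charFunDual (funext fun ℓ => ?_)
  obtain ⟨a, b, w, hl⟩ := exists_dual_obs_eq ℓ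
  rw [charFunDual_obsLaw (v := v) rfl (by linarith) ℓ hl,
    Measure.map_map (measurable_rotatedObs τ) (measurable_respond _), charFunDual_map_stdLaw]
  · congr 2
    have hu1 : 1 - v ⬝ᵥ v ≠ 0 := by linarith
    have e0 : ℓ ((rotatedObs τ ∘ respond (rotatedCoeff v)) (1, 0)) =
        (√2)⁻¹ * √(1 - 2 * (v ⬝ᵥ v)) * (τ * a + b) := by
      simp only [Function.comp_apply, respond, rotatedObs, hl, rotatedCoeff_dotProduct]
      simp [dotProduct]; ring
    have e1 : ℓ ((rotatedObs τ ∘ respond (rotatedCoeff v)) (0, Pi.single 0 1)) =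
        (√2)⁻¹ * (τ * a - b) := by
      simp only [Function.comp_apply, respond, rotatedObs, hl]
      simp [dotProduct, rotatedCoeff, Fin.sum_univ_succ]
      ring
    have e2 : ∀ j : Fin q, ℓ ((rotatedObs τ ∘ respond (rotatedCoeff v)) (0, Pi.single j.succ 1)) =
        w j + (τ * a + b) * v j := fun j => by
      simp only [Function.comp_apply, respond, rotatedObs, hl, single_one_dotProduct]
      have : (fun i : Fin q => (Pi.single j.succ (1 : ℝ) : Fin (q + 1) → ℝ) i.succ) =
          Pi.single j 1 := by
        ext i; simp [Pi.single_apply]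
      rw [this, single_one_dotProduct]
      simp [rotatedCoeff]
      ring
    rw [Fin.sum_univ_succ, e0, e1]
    simp_rw [e2]
    have e3 : ∑ j, (w j + (τ * a + b) * v j) ^ 2 = w ⬝ᵥ w + 2 * (τ * a + b) * (v ⬝ᵥ w) +
        (τ * a + b) ^ 2 * (v ⬝ᵥ v) := by
      simp only [dotProduct, Finset.mul_sum, ← Finset.sum_add_distrib]
      exact Finset.sum_congr rfl fun i _ => by ring
    have h2 : ((√2)⁻¹) ^ 2 = (1 / 2 : ℝ) := by rw [inv_pow, Real.sq_sqrt (by norm_num)]; norm_num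
    rw [e3, mul_pow, mul_pow, mul_pow, h2, Real.sq_sqrt (by linarith)]
    simp only [confoundedParam, dotProduct_add, add_dotProduct, dotProduct_smul, smul_dotProduct,
      smul_eq_mul, dotProduct_comm w v]
    rw [mul_pow, Real.sq_sqrt (div_nonneg (by linarith) (by linarith))]
    field_simp
    ring
  · constructor
    · intro x y
      ext <;> simp [respond, rotatedObs, add_dotProduct] <;> ring_nf
    · intro c x
      ext <;> simp [respond, rotatedObs, smul_dotProduct] <;> ring_nf

theorem obsLaw_simpleParam {q : ℕ} (τ : ℝ) {b : ℝ} (hb : b ^ 2 < 1) :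
    obsLaw (simpleParam q τ b) =
      ((stdLaw (q + 1)).map (respond (Pi.single 0 b))).map (scaledObs τ) := by
  have := isProbabilityMeasure_obsLaw (simpleParam q τ b)
  have := Measure.isProbabilityMeasure_map (μ := stdLaw (q + 1))
    (measurable_respond (Pi.single 0 b)).aemeasurable
  have := Measure.isProbabilityMeasure_map
    (μ := (stdLaw (q + 1)).map (respond (Pi.single 0 b))) (measurable_scaledObs τ).aemeasurable
  refine Measure.ext_of_charFunDual (funext fun ℓ => ?_)
  obtain ⟨a, d, w, hl⟩ := exists_dual_obs_eq ℓ
  rw [charFunDual_obsLaw (v := 0) rfl (by simp) ℓ hl,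
    Measure.map_map (measurable_scaledObs τ) (measurable_respond _), charFunDual_map_stdLaw]
  · congr 2
    have e0 : ℓ ((scaledObs τ ∘ respond (Pi.single 0 b)) (1, 0)) = √(1 - b ^ 2) * (τ * a) := by
      simp only [Function.comp_apply, respond, scaledObs, hl]
      rw [single_dotProduct]
      simp [← sq]; ring
    have e1 : ℓ ((scaledObs τ ∘ respond (Pi.single 0 b)) (0, Pi.single 0 1)) =
        τ * b * a + d := by
      simp only [Function.comp_apply, respond, scaledObs, hl, single_one_dotProduct]
      simp [dotProduct]
    have e2 : ∀ j : Fin q, ℓ ((scaledObs τ ∘ respond (Pi.single 0 b)) (0, Pi.single j.succ 1)) =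
        w j := fun j => by
      simp only [Function.comp_apply, respond, scaledObs, hl]
      have : (fun i : Fin q => (Pi.single j.succ (1 : ℝ) : Fin (q + 1) → ℝ) i.succ) =
          Pi.single j 1 := by
        ext i; simp [Pi.single_apply]
      rw [this, single_one_dotProduct]
      simp
    rw [Fin.sum_univ_succ, e0, e1]
    simp_rw [e2]
    rw [mul_pow, Real.sq_sqrt (by linarith)]
    simp only [simpleParam, smul_zero, zero_add, zero_dotProduct]
    rw [mul_pow, Real.sq_sqrt (by linarith)]
    simp only [dotProduct, ← sq]
    ring
  · constructor
    · intro x y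
      ext <;> simp [respond, scaledObs]
      ring_nf
    · intro c x
      ext <;> simp [respond, scaledObs]
      ring_nf

theorem map_respond_zero (p : ℕ) : (stdLaw p).map (respond 0) = stdLaw p := by
  have : respond (0 : Fin p → ℝ) = id := by
    ext z <;> simp [respond]
  rw [this, Measure.map_id]

/-! ### The parametric rate -/

/-- The parametric lower bound. -/
theorem parametric_le_minimaxLength {M M₁ M₂ α τ : ℝ} (hM : 1 < M) (hα₁ : α < 1 / 3)
    {n q s : ℕ} (hn : 1 ≤ n) (hs : 1 ≤ s) (hτ : 0 ≤ τ) (hτ₁ : τ ≤ M₁) (hτ₂ : τ ≤ M₂) :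
    ENNReal.ofReal (τ / 42 * (√n)⁻¹) ≤ minimaxLength n α (theta M M₁ M₂ q s) := by
  have hn' : (1 : ℝ) ≤ n := by exact_mod_cast hn
  -- With `n b² = 1/49`, Bernoulli's inequality bounds the second moment `(1 - b²)⁻ⁿ` by `49/48 ≤
  -- 37/36`; the separation `τ b` divided by `6` gives the constant `1/42`.
  set b : ℝ := (√n)⁻¹ / 7 with hb
  have hb0 : 0 ≤ b := by positivity
  have hb2 : b ^ 2 = (49 * n : ℝ)⁻¹ := by
    rw [hb, div_pow, inv_pow, Real.sq_sqrt (by positivity), mul_inv]; ring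
  have hnb : (n : ℝ) * b ^ 2 = 1 / 49 := by rw [hb2]; field_simp
  have hb1 : b ^ 2 < 1 := by nlinarith [sq_nonneg b]
  have hdot : (Pi.single 0 b : Fin (q + 1) → ℝ) ⬝ᵥ Pi.single 0 b = b ^ 2 := by
    rw [single_dotProduct]; simp [sq]
  have hmem : ∀ x : ℝ, x ^ 2 ≤ 1 → simpleParam q τ x ∈ theta M M₁ M₂ q s := fun x hx => by
    refine mem_theta_of_borderedCov (v := 0) (k := 0) hM (hτ.trans hτ₂) rfl ?_ (by simp)
      (by simpa using hs) (mul_nonneg hτ (Real.sqrt_nonneg _)) ?_ ?_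
    · simpa using sq_nonneg _
    · refine le_trans (mul_le_of_le_one_right hτ ?_) hτ₁
      exact Real.sqrt_le_one.2 (by linarith [sq_nonneg x])
    · simp only [simpleParam, zero_dotProduct, add_zero, mul_pow]
      nlinarith [sq_nonneg τ]
  have hprob := isProbabilityMeasure_withDensity_likelihood (hdot.trans_lt hb1)
  refine le_trans (le_of_eq ?_) (le_minimaxLength_of_mixture hα₁ (ι := Unit) (simpleParam q τ 0)
    (fun _ => simpleParam q τ b) (τ * b) (hmem 0 (by simp)) (fun _ => hmem b hb1.le)
    (fun _ => rfl) fun F hF => dataLaw_mixture_le (stdLaw (q + 1)) (scaledObs τ)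
      (measurable_scaledObs τ) (fun _ => likelihood (Pi.single 0 b))
      (fun _ => measurable_likelihood _) _ _ ?_ (fun _ => ?_) ?_ hF)
  · congr 1
    simp only [simpleParam, mul_zero, zero_sub, abs_neg]
    rw [abs_of_nonneg (mul_nonneg hτ hb0), hb]
    ring
  · rw [obsLaw_simpleParam τ (by simp), Pi.single_zero, map_respond_zero]
  · rw [obsLaw_simpleParam τ hb1, map_respond_eq_withDensity (hdot.trans_lt hb1)]
  · simp only [Finset.univ_unique, Finset.sum_singleton, Fintype.card_unit, Nat.cast_one, one_pow,
      mul_one]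
    rw [lintegral_likelihood_mul (hdot.trans_lt hb1) (hdot.trans_lt hb1), hdot,
      ← ENNReal.ofReal_pow (inv_nonneg.2 (by linarith))]
    have h1 : (48 / 49 : ℝ) ≤ (1 - b ^ 2) ^ n := by
      have := one_add_mul_le_pow (a := -b ^ 2) (by linarith) n
      rw [← sub_eq_add_neg] at this
      linarith
    have h2 : ((1 - b ^ 2)⁻¹) ^ n ≤ (37 / 36 : ℝ) := by
      rw [inv_pow]
      exact (inv_anti₀ (by norm_num) h1).trans (by norm_num)
    refine (ENNReal.ofReal_le_ofReal h2).trans (le_of_eq ?_)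
    rw [ENNReal.ofReal_div_of_pos (by norm_num)]; simp

/-! ### Block-sparse spikes and the confounding bound -/

/-- The vector with entry `ρ` at one position of each of `k` blocks. -/
def spikes {k m q : ℕ} (pos : Fin k × Fin m → Fin q) (ρ : ℝ) (g : Fin k → Fin m) : Fin q → ℝ :=
  ∑ i, Pi.single (pos (i, g i)) ρ

/-- The number of coordinates at which two functions agree. -/
def agreement {k m : ℕ} (g h : Fin k → Fin m) : ℕ := (Finset.univ.filter fun i => g i = h i).card

theorem agreement_le {k m : ℕ} (g h : Fin k → Fin m) : agreement g h ≤ k := by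
  simpa [agreement] using Finset.card_filter_le (Finset.univ : Finset (Fin k)) fun i => g i = h i

theorem agreement_self {k m : ℕ} (g : Fin k → Fin m) : agreement g g = k := by
  simp [agreement]

theorem spikes_dotProduct {k m q : ℕ} {pos : Fin k × Fin m → Fin q} (hpos : pos.Injective)
    (ρ : ℝ) (g h : Fin k → Fin m) :
    spikes pos ρ g ⬝ᵥ spikes pos ρ h = ρ ^ 2 * agreement g h := by
  have : ∀ i j, (Pi.single (pos (i, g i)) ρ : Fin q → ℝ) ⬝ᵥ Pi.single (pos (j, h j)) ρ =
      if i = j then (if g i = h i then ρ ^ 2 else 0) else 0 := fun i j => by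
    rw [single_dotProduct, Pi.single_apply]
    by_cases hij : i = j
    · subst hij
      simp [hpos.eq_iff, sq]
    · simp [hpos.eq_iff, hij]
  simp only [spikes, sum_dotProduct, dotProduct_sum, this]
  simp only [Finset.sum_ite_eq', Finset.mem_univ, if_true]
  rw [← Finset.sum_filter, Finset.sum_const, nsmul_eq_mul, agreement, mul_comm]

theorem hammingNorm_spikes_le {k m q : ℕ} (pos : Fin k × Fin m → Fin q) (ρ : ℝ)
    (g : Fin k → Fin m) : hammingNorm (spikes pos ρ g) ≤ k := by
  have hsub : (Finset.univ.filter fun j => spikes pos ρ g j ≠ 0) ⊆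
      Finset.univ.image fun i => pos (i, g i) := by
    intro j hj
    simp only [Finset.mem_filter, Finset.mem_univ, true_and, spikes, Finset.sum_apply] at hj
    obtain ⟨i, -, hi⟩ := Finset.exists_ne_zero_of_sum_ne_zero hj
    refine Finset.mem_image.2 ⟨i, Finset.mem_univ _, ?_⟩
    by_contra hne
    exact hi (Pi.single_eq_of_ne (Ne.symm hne) _)
  exact (Finset.card_le_card hsub).trans (Finset.card_image_le.trans (by simp))

/-- The exponential factorizes over the blocks, which are chosen independently; in each block one of
the `m` positions agrees with a given one. -/
theorem sum_exp_agreement (k m : ℕ) (t : ℝ) :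
    ∑ g : Fin k → Fin m, ∑ h : Fin k → Fin m, Real.exp (t * agreement g h) =
      ((m : ℝ) * (m - 1 + Real.exp t)) ^ k := by
  have h1 : ∀ g h : Fin k → Fin m, Real.exp (t * agreement g h) =
      ∏ i, if g i = h i then Real.exp t else 1 := fun g h => by
    rw [← Finset.prod_filter, Finset.prod_const, ← agreement, mul_comm, Real.exp_nat_mul]
  have h2 : ∀ a : Fin m, ∑ b : Fin m, (if a = b then Real.exp t else 1) =
      (m : ℝ) - 1 + Real.exp t := fun a => by
    have : ∀ b : Fin m, (if a = b then Real.exp t else 1) =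
        1 + if a = b then Real.exp t - 1 else 0 := fun b => by split_ifs <;> ring
    simp only [this, Finset.sum_add_distrib, Finset.sum_ite_eq]
    simp; ring
  have h3 : ∀ g : Fin k → Fin m, ∑ h : Fin k → Fin m, Real.exp (t * agreement g h) =
      ((m : ℝ) - 1 + Real.exp t) ^ k := fun g => by
    have := Finset.prod_univ_sum (fun _ : Fin k => (Finset.univ : Finset (Fin m)))
      (fun i b => if g i = b then Real.exp t else 1)
    rw [Fintype.piFinset_univ] at this
    simp_rw [h1, ← this, h2]
    simp
  simp_rw [h3]
  simp [mul_pow]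

theorem inv_one_sub_le_exp {x : ℝ} (hx0 : 0 ≤ x) (hx : x ≤ 1 / 2) :
    (1 - x)⁻¹ ≤ Real.exp (2 * x) := by
  have : (1 - x)⁻¹ ≤ 2 * x + 1 := by
    rw [inv_le_iff_one_le_mul₀ (by linarith)]; nlinarith
  exact this.trans (Real.add_one_le_exp _)

/-- Since `2r · agreement ≤ 1/2`, each `n`-th power is at most `exp(4rn · agreement)`. The average
over pairs is then `(1 + (exp(4rn) - 1)/m)^k ≤ exp(k exp(4rn)/m)`. -/
theorem sum_second_moment_le {k m n : ℕ} {r : ℝ} (hm : 1 ≤ m) (hr : 0 ≤ r)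
    (hr' : 2 * r * k ≤ 1 / 2) (hexp : k * Real.exp (4 * r * n) / m ≤ 1 / 37) :
    ∑ g : Fin k → Fin m, ∑ h : Fin k → Fin m,
      (ENNReal.ofReal (1 - 2 * (r * agreement g h))⁻¹) ^ n ≤
        37 / 36 * (Fintype.card (Fin k → Fin m) : ENNReal) ^ 2 := by
  have hm' : (0 : ℝ) < m := by exact_mod_cast hm
  have h1 : ∀ g h : Fin k → Fin m, (ENNReal.ofReal (1 - 2 * (r * agreement g h))⁻¹) ^ n ≤
      ENNReal.ofReal (Real.exp (4 * r * n * agreement g h)) := fun g h => by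
    have hJ : (agreement g h : ℝ) ≤ k := by exact_mod_cast agreement_le g h
    have hx : 2 * (r * agreement g h) ≤ 1 / 2 := by nlinarith
    have := inv_one_sub_le_exp (x := 2 * (r * agreement g h)) (by positivity) hx
    rw [← ENNReal.ofReal_pow (inv_nonneg.2 (by linarith))]
    refine ENNReal.ofReal_le_ofReal ?_
    refine (pow_le_pow_left₀ (inv_nonneg.2 (by linarith)) this n).trans (le_of_eq ?_)
    rw [← Real.exp_nat_mul]; congr 1; ring
  have h2 : ((m : ℝ) * (m - 1 + Real.exp (4 * r * n))) ^ k ≤ 37 / 36 * ((m : ℝ) ^ k) ^ 2 := by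
    have e : (m : ℝ) * (m - 1 + Real.exp (4 * r * n)) =
        m ^ 2 * (1 + (Real.exp (4 * r * n) - 1) / m) := by field_simp; ring
    have hle : 1 + (Real.exp (4 * r * n) - 1) / m ≤ Real.exp (Real.exp (4 * r * n) / m) := by
      refine le_trans ?_ (Real.add_one_le_exp _)
      rw [add_comm]
      gcongr
      linarith
    have h0 : 0 ≤ 1 + (Real.exp (4 * r * n) - 1) / m := by
      have : 1 ≤ Real.exp (4 * r * n) := Real.one_le_exp (by positivity)
      have : 0 ≤ (Real.exp (4 * r * n) - 1) / m := div_nonneg (by linarith) hm'.le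
      linarith
    have h3 : (1 + (Real.exp (4 * r * n) - 1) / m) ^ k ≤ 37 / 36 := by
      refine (pow_le_pow_left₀ h0 hle k).trans ?_
      -- The threshold `1/37` is chosen so that `exp(1/37) ≤ (1 - 1/37)⁻¹ = 37/36`.
      rw [← Real.exp_nat_mul, ← mul_div_assoc]
      refine (Real.exp_le_exp.2 hexp).trans ?_
      have := Real.one_sub_le_exp_neg (1 / 37)
      rw [Real.exp_neg] at this
      have h4 := inv_anti₀ (by norm_num) this
      rw [inv_inv] at h4
      exact h4.trans (by norm_num)
    rw [e, mul_pow, ← pow_mul, ← pow_mul, mul_comm k 2, mul_comm]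
    gcongr
  calc _ ≤ ∑ g : Fin k → Fin m, ∑ h : Fin k → Fin m,
        ENNReal.ofReal (Real.exp (4 * r * n * agreement g h)) :=
        Finset.sum_le_sum fun g _ => Finset.sum_le_sum fun h _ => h1 g h
    _ = ENNReal.ofReal (((m : ℝ) * (m - 1 + Real.exp (4 * r * n))) ^ k) := by
        rw [← sum_exp_agreement, ENNReal.ofReal_sum_of_nonneg fun g _ =>
          Finset.sum_nonneg fun h _ => (Real.exp_pos _).le]
        exact Finset.sum_congr rfl fun g _ =>
          (ENNReal.ofReal_sum_of_nonneg fun h _ => (Real.exp_pos _).le).symm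
    _ ≤ ENNReal.ofReal (37 / 36 * ((m : ℝ) ^ k) ^ 2) := ENNReal.ofReal_le_ofReal h2
    _ = _ := by
        rw [ENNReal.ofReal_mul (by norm_num), ENNReal.ofReal_div_of_pos (by norm_num),
          ENNReal.ofReal_pow (by positivity), ENNReal.ofReal_pow (by positivity)]
        simp

/-- The lower bound from sparse confounding of the regressor of interest. -/
theorem confounding_le_minimaxLength {M M₁ M₂ α τ r : ℝ} (hM : 1 < M) (hα₁ : α < 1 / 3)
    {n q s k m : ℕ} (hτ : 0 ≤ τ) (hτ₁ : τ ≤ M₁) (hτ₂ : τ ≤ M₂) (hm : 1 ≤ m)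
    (hkm : k * m ≤ q) (hks : k + 1 ≤ s) (hr : 0 ≤ r) (hrk : r * k ≤ 1 / 4)
    (hrM : r * k ≤ (1 - M⁻¹) ^ 2) (hexp : k * Real.exp (4 * r * n) / m ≤ 1 / 37) :
    ENNReal.ofReal (τ * (r * k) / 6) ≤ minimaxLength n α (theta M M₁ M₂ q s) := by
  have : Nonempty (Fin k → Fin m) := ⟨fun _ => ⟨0, hm⟩⟩
  set pos : Fin k × Fin m → Fin q := fun x => Fin.castLE hkm (finProdFinEquiv x) with hposdef
  have hpos : pos.Injective := (Fin.castLE_injective hkm).comp finProdFinEquiv.injective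
  have hdot : ∀ g h : Fin k → Fin m, spikes pos (√r) g ⬝ᵥ spikes pos (√r) h =
      r * agreement g h := fun g h => by
    rw [spikes_dotProduct hpos, Real.sq_sqrt hr]
  have hself : ∀ g : Fin k → Fin m, spikes pos (√r) g ⬝ᵥ spikes pos (√r) g = r * k := fun g => by
    rw [hdot, agreement_self]
  have hrot : ∀ g : Fin k → Fin m,
      rotatedCoeff (spikes pos (√r) g) ⬝ᵥ rotatedCoeff (spikes pos (√r) g) < 1 := fun g => by
    rw [rotatedCoeff_dotProduct, hself]; linarith
  have hmem : ∀ v : Fin q → ℝ, v ⬝ᵥ v ≤ r * k → hammingNorm v ≤ k →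
      confoundedParam τ v ∈ theta M M₁ M₂ q s := fun v hv hvk => by
    have hv0 : 0 ≤ v ⬝ᵥ v := Finset.sum_nonneg fun i _ => mul_self_nonneg _
    have hv1 : 0 < 1 - v ⬝ᵥ v := by linarith
    refine mem_theta_of_borderedCov (v := v) hM (hτ.trans hτ₂) rfl (hv.trans hrM) hvk hks
      (mul_nonneg hτ (Real.sqrt_nonneg _)) ?_ ?_
    · refine le_trans (mul_le_of_le_one_right hτ ?_) hτ₁
      exact Real.sqrt_le_one.2 ((div_le_one hv1).2 (by linarith))
    · simp only [confoundedParam, dotProduct_smul, smul_dotProduct, smul_eq_mul]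
      set u := v ⬝ᵥ v
      have e : (-(τ * u / (1 - u))) ^ 2 + τ / (1 - u) * (τ / (1 - u) * u) =
          τ ^ 2 * ((u ^ 2 + u) / (1 - u) ^ 2) := by field_simp
      -- The inequality amounts to `3u ≤ 1`, and `u ≤ rk ≤ 1/4`.
      have h1 : (u ^ 2 + u) / (1 - u) ^ 2 ≤ 1 := by
        rw [div_le_one (by positivity)]; nlinarith
      rw [e]
      calc τ ^ 2 * ((u ^ 2 + u) / (1 - u) ^ 2) ≤ τ ^ 2 * 1 := by gcongr
        _ ≤ M₂ ^ 2 := by rw [mul_one]; gcongr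
  have hprob : ∀ g : Fin k → Fin m, IsProbabilityMeasure
      ((stdLaw (q + 1)).withDensity (likelihood (rotatedCoeff (spikes pos (√r) g)))) := fun g =>
    isProbabilityMeasure_withDensity_likelihood (hrot g)
  refine le_trans (ENNReal.ofReal_le_ofReal ?_) (le_minimaxLength_of_mixture hα₁
    (ι := Fin k → Fin m) (confoundedParam τ 0) (fun g => confoundedParam τ (spikes pos (√r) g))
    (-(τ * (r * k) / (1 - r * k))) (hmem 0 (by simpa using by positivity) (by simp))
    (fun g => hmem _ (hself g).le (hammingNorm_spikes_le _ _ _))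
    (fun g => by simp only [confoundedParam, hself]) fun F hF =>
      dataLaw_mixture_le (stdLaw (q + 1)) (rotatedObs τ)
      (measurable_rotatedObs τ) (fun g => likelihood (rotatedCoeff (spikes pos (√r) g)))
      (fun _ => measurable_likelihood _) _ _ ?_ (fun g => ?_) ?_ hF)
  · have h0 : (confoundedParam τ (0 : Fin q → ℝ)).β = 0 := by simp [confoundedParam]
    have hx : 0 ≤ τ * (r * k) := by positivity
    rw [h0, sub_neg_eq_add, zero_add, abs_of_nonneg (div_nonneg hx (by linarith))]
    gcongr
    exact le_div_self hx (by linarith) (by linarith [mul_nonneg hr (Nat.cast_nonneg (α := ℝ) k)])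
  · have : rotatedCoeff (0 : Fin q → ℝ) = 0 := by
      ext i; cases i using Fin.cases <;> simp [rotatedCoeff]
    rw [obsLaw_confoundedParam τ (by simp), this, map_respond_zero]
  · rw [obsLaw_confoundedParam τ (by rw [hself]; linarith), map_respond_eq_withDensity (hrot g)]
  · simp_rw [lintegral_likelihood_mul (hrot _) (hrot _), rotatedCoeff_dotProduct, hdot]
    exact sum_second_moment_le hm hr (by linarith) hexp

/-! ### Choice of the constants -/

theorem confounding_rate_le_minimaxLength {M M₁ M₂ α τ c κ : ℝ} (hM : 1 < M) (hα₁ : α < 1 / 3)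
    (hc : c < 1 / 2) {n q s : ℕ} (hn : 1 ≤ n) (hτ : 0 ≤ τ) (hτ₁ : τ ≤ M₁) (hτ₂ : τ ≤ M₂)
    (hκ : 0 ≤ κ) (hκ1 : κ ≤ 1) (hκM : κ / 4 ≤ (1 - M⁻¹) ^ 2) (hκc : 4 * κ ≤ (1 - 2 * c) / 2)
    (hsn : (s : ℝ) * (n : ℝ)⁻¹ * Real.log ((q + 1 : ℕ) : ℝ) ≤ 1 / 4) (hs : 2 ≤ s)
    (hsp : (s : ℝ) ≤ ((q + 1 : ℕ) : ℝ) ^ c)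
    (hlarge : 148 ≤ ((q + 1 : ℕ) : ℝ) ^ ((1 - 2 * c) / 2)) :
    ENNReal.ofReal (τ * κ / 12 * ((s : ℝ) * (n : ℝ)⁻¹ * Real.log ((q + 1 : ℕ) : ℝ))) ≤
      minimaxLength n α (theta M M₁ M₂ q s) := by
  have hn' : (0 : ℝ) < n := by exact_mod_cast hn
  set p : ℝ := ((q + 1 : ℕ) : ℝ) with hp
  have hp1 : 1 ≤ p := by rw [hp]; exact_mod_cast Nat.le_add_left 1 q
  have hp0 : 0 < p := by linarith
  have hlog : 0 ≤ Real.log p := Real.log_nonneg hp1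
  -- One non-zero entry of the precision row is spent on the coordinate of `Z`, leaving `k = s - 1`
  -- for the spikes; `s ≥ 2` gives `k ≥ 1` and `s ≤ 2k`.
  obtain ⟨k, rfl⟩ : ∃ k, s = k + 1 := ⟨s - 1, by omega⟩
  have hk1 : 1 ≤ k := by omega
  have hk1' : (1 : ℝ) ≤ k := by exact_mod_cast hk1
  have hkp : (k : ℝ) + 1 ≤ p ^ c := by exact_mod_cast hsp
  have hk2 : (k : ℝ) ^ 2 ≤ p ^ (2 * c) := by
    rw [mul_comm, Real.rpow_mul hp0.le, Real.rpow_two]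
    gcongr; linarith
  have hpc : p ^ c ≤ p := by
    conv_rhs => rw [← Real.rpow_one p]
    exact Real.rpow_le_rpow_of_exponent_le hp1 (by linarith)
  have hkq : k ≤ q := by
    have : (k : ℝ) + 1 ≤ q + 1 := hkp.trans (hpc.trans (by rw [hp]; push_cast; rfl))
    have : (k : ℝ) ≤ q := by linarith
    exact_mod_cast this
  set m := q / k with hm
  have hm1 : 1 ≤ m := (Nat.one_le_div_iff hk1).2 hkq
  have hm1' : (1 : ℝ) ≤ m := by exact_mod_cast hm1
  have hkm : k * m ≤ q := Nat.mul_div_le q k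
  have hmq : p ≤ 4 * k * m := by
    have h1 : q < k * (m + 1) := Nat.lt_mul_div_succ q hk1
    have h2 : (q : ℝ) ≤ k * (m + 1) := by exact_mod_cast h1.le
    have h3 : p = q + 1 := by rw [hp]; push_cast; rfl
    nlinarith [mul_le_mul hk1' hm1' (by norm_num) (by linarith)]
  set r : ℝ := κ * ((n : ℝ)⁻¹ * Real.log p) with hr
  have hr0 : 0 ≤ r := by positivity
  have hsn' : ((k : ℝ) + 1) * (n : ℝ)⁻¹ * Real.log p ≤ 1 / 4 := by exact_mod_cast hsn
  have hx0 : 0 ≤ (n : ℝ)⁻¹ * Real.log p := by positivity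
  have hrk : r * k ≤ κ / 4 := by
    have : (n : ℝ)⁻¹ * Real.log p * k ≤ 1 / 4 := by nlinarith
    rw [hr]; nlinarith
  have hexp : k * Real.exp (4 * r * n) / m ≤ 1 / 37 := by
    have e1 : Real.exp (4 * r * n) = p ^ (4 * κ) := by
      rw [Real.rpow_def_of_pos hp0, hr]; congr 1; field_simp
    have e2 : (m : ℝ)⁻¹ ≤ 4 * k / p := by
      rw [inv_le_iff_one_le_mul₀ (by linarith), div_mul_eq_mul_div, one_le_div hp0]; exact hmq
    have e3 : p ^ (4 * κ) ≤ p ^ ((1 - 2 * c) / 2) := Real.rpow_le_rpow_of_exponent_le hp1 hκc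
    have e4 : p ^ (2 * c) * p ^ ((1 - 2 * c) / 2) * p ^ ((1 - 2 * c) / 2) = p := by
      rw [← Real.rpow_add hp0, ← Real.rpow_add hp0]
      conv_rhs => rw [← Real.rpow_one p]
      congr 1; ring
    -- Half of the spare exponent `1 - 2c` pays for `exp(4rn) = p^(4κ) ≤ P`; the other half leaves
    -- `4/P`, which is at most `1/37` once `P ≥ 148 = 4 · 37`.
    set P := p ^ ((1 - 2 * c) / 2)
    have hP : 0 < P := by positivity
    calc k * Real.exp (4 * r * n) / m ≤ k * P * (4 * k / p) := by
          rw [e1, div_eq_mul_inv]; gcongr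
      _ = 4 * ((k : ℝ) ^ 2 * P / p) := by ring
      _ ≤ 4 * (p ^ (2 * c) * P / p) := by gcongr
      _ = 4 / P := by
          have : p ^ (2 * c) * P / p = 1 / P := by
            rw [div_eq_div_iff hp0.ne' hP.ne']; linarith
          rw [this]; ring
      _ ≤ 1 / 37 := by rw [div_le_div_iff₀ hP (by norm_num)]; linarith
  refine le_trans (ENNReal.ofReal_le_ofReal ?_) (confounding_le_minimaxLength hM hα₁ hτ hτ₁ hτ₂ hm1
    hkm le_rfl hr0 (hrk.trans (by linarith)) (hrk.trans hκM) hexp)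
  have e : τ * (r * k) / 6 = τ * κ / 12 * ((2 * k) * ((n : ℝ)⁻¹ * Real.log p)) := by
    rw [hr]; ring
  rw [e, mul_assoc ((k + 1 : ℕ) : ℝ)]
  gcongr
  push_cast; linarith

theorem exists_rate_le_minimaxLength {M M₁ M₂ c α : ℝ} (hM : 1 < M) (hM₁ : 0 < M₁) (hM₂ : 0 < M₂)
    (hc : c < 1 / 2) (hα₁ : α < 1 / 3) :
    ∃ C : ℝ, 0 < C ∧
      ∀ n p q s : ℕ, 1 ≤ n → p = q + 1 →
        (s : ℝ) * (n : ℝ)⁻¹ * Real.log (p : ℝ) ≤ 1 / 4 →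
        2 ≤ s → (s : ℝ) ≤ (p : ℝ) ^ c →
          ENNReal.ofReal
              (C * ((n : ℝ) ^ (-(1 / 2) : ℝ) + (s : ℝ) * (n : ℝ)⁻¹ * Real.log (p : ℝ)))
            ≤ minimaxLength n α (theta M M₁ M₂ q s) := by
  have hMi : 0 < 1 - M⁻¹ := sub_pos.2 (inv_lt_one_of_one_lt₀ hM)
  set τ := min M₁ M₂ with hτdef
  have hτ : 0 < τ := lt_min hM₁ hM₂
  set κ := min ((1 - 2 * c) / 8) (min 1 (4 * (1 - M⁻¹) ^ 2)) with hκdef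
  have hκ : 0 < κ := lt_min (by linarith) (lt_min one_pos (by positivity))
  have hκc : κ ≤ (1 - 2 * c) / 8 := min_le_left _ _
  have hκ1 : κ ≤ 1 := (min_le_right _ _).trans (min_le_left _ _)
  have hκM : κ ≤ 4 * (1 - M⁻¹) ^ 2 := (min_le_right _ _).trans (min_le_right _ _)
  have he : 0 < (1 - 2 * c) / 2 := by linarith
  set P : ℝ := (148 : ℝ) ^ ((1 - 2 * c) / 2)⁻¹ with hP
  have hP0 : 0 < P := by positivity
  -- The three terms serve bounded `p`, dominant `n^{-1/2}`, and dominant `s log p / n`; in the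
  -- latter two cases the sum is at most twice its larger term, which halves the constants `τ/42`
  -- and `τκ/12`.
  set C := min (τ / 42 / (1 + P ^ 2)) (min (τ / 84) (τ * κ / 24)) with hC
  have hC0 : 0 < C := lt_min (by positivity) (lt_min (by positivity) (by positivity))
  have hC1 : C ≤ τ / 42 / (1 + P ^ 2) := min_le_left _ _
  have hC2 : C ≤ τ / 84 := (min_le_right _ _).trans (min_le_left _ _)
  have hC3 : C ≤ τ * κ / 24 := (min_le_right _ _).trans (min_le_right _ _)
  refine ⟨C, hC0, fun n p q s hn hpq hsn hs hsp => ?_⟩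
  subst hpq
  have hn' : (1 : ℝ) ≤ n := by exact_mod_cast hn
  have hroot : (n : ℝ) ^ (-(1 / 2) : ℝ) = (√n)⁻¹ := by
    rw [Real.rpow_neg (by positivity), Real.sqrt_eq_rpow]
  rw [hroot]
  have hpar := parametric_le_minimaxLength (q := q) (s := s) hM hα₁ hn (by omega) hτ.le
    (min_le_left M₁ M₂) (min_le_right M₁ M₂)
  have hp1 : (1 : ℝ) ≤ ((q + 1 : ℕ) : ℝ) := by exact_mod_cast Nat.le_add_left 1 q
  have hlog : 0 ≤ Real.log ((q + 1 : ℕ) : ℝ) := Real.log_nonneg hp1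
  have hrate : 0 ≤ (s : ℝ) * (n : ℝ)⁻¹ * Real.log ((q + 1 : ℕ) : ℝ) := by positivity
  have hroot0 : 0 < (√(n : ℝ))⁻¹ := by positivity
  by_cases hlarge : 148 ≤ ((q + 1 : ℕ) : ℝ) ^ ((1 - 2 * c) / 2)
  · have hconf := confounding_rate_le_minimaxLength hM hα₁ hc hn hτ.le
      (min_le_left M₁ M₂) (min_le_right M₁ M₂) hκ.le hκ1 (by linarith) (by linarith) hsn hs hsp
      hlarge
    rcases le_total ((s : ℝ) * (n : ℝ)⁻¹ * Real.log ((q + 1 : ℕ) : ℝ)) (√(n : ℝ))⁻¹ with h | h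
    · refine le_trans (ENNReal.ofReal_le_ofReal ?_) hpar
      nlinarith
    · refine le_trans (ENNReal.ofReal_le_ofReal ?_) hconf
      nlinarith
  -- For `p` below the fixed threshold `P`, both `s` and `log p` are at most `P`, so `s log p / n ≤
  -- P² n^{-1/2}` and the parametric bound alone suffices.
  · push Not at hlarge
    have hpP : ((q + 1 : ℕ) : ℝ) ≤ P :=
      ((Real.lt_rpow_inv_iff_of_pos (by positivity) (by norm_num) he).2 hlarge).le
    have hsP : (s : ℝ) ≤ P := by
      refine (hsp.trans ?_).trans hpP
      conv_rhs => rw [← Real.rpow_one ((q + 1 : ℕ) : ℝ)]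
      exact Real.rpow_le_rpow_of_exponent_le hp1 (by linarith)
    have hlP : Real.log ((q + 1 : ℕ) : ℝ) ≤ P := (Real.log_le_self (by positivity)).trans hpP
    have hinv : (n : ℝ)⁻¹ ≤ (√n)⁻¹ := by
      refine inv_anti₀ (by positivity) ?_
      exact Real.sqrt_le_iff.2 ⟨by positivity, by nlinarith⟩
    refine le_trans (ENNReal.ofReal_le_ofReal ?_) hpar
    calc C * ((√(n : ℝ))⁻¹ + (s : ℝ) * (n : ℝ)⁻¹ * Real.log ((q + 1 : ℕ) : ℝ))
        ≤ C * ((√(n : ℝ))⁻¹ + P * (√(n : ℝ))⁻¹ * P) := by gcongr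
      _ = C * (1 + P ^ 2) * (√(n : ℝ))⁻¹ := by ring
      _ ≤ τ / 42 * (√(n : ℝ))⁻¹ := by
          gcongr
          rwa [le_div_iff₀ (by positivity)] at hC1

end DenseLinearModel

end

theorem corollary2 (M M₁ M₂ c α : ℝ) (hM : 1 < M) (hM₁ : 0 < M₁) (hM₂ : 0 < M₂)
    (hc : c < 1 / 2) (hα₀ : 0 < α) (hα₁ : α < 1 / 3) :
    ∃ C : ℝ, 0 < C ∧
      ∀ n p q s : ℕ, 1 ≤ n → p = q + 1 →
        (s : ℝ) * (n : ℝ)⁻¹ * Real.log (p : ℝ) ≤ 1 / 4 →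
        2 ≤ s → (s : ℝ) ≤ (p : ℝ) ^ c →
          ENNReal.ofReal
              (C * ((n : ℝ) ^ (-(1 / 2) : ℝ) + (s : ℝ) * (n : ℝ)⁻¹ * Real.log (p : ℝ)))
            ≤ DenseLinearModel.minimaxLength n α (DenseLinearModel.theta M M₁ M₂ q s) ∧
          ENNReal.ofReal
              (C * ((n : ℝ) ^ (-(1 / 2) : ℝ) + (s : ℝ) * (n : ℝ)⁻¹ * Real.log (p : ℝ)))
            ≤ DenseLinearModel.minimaxLength n α (DenseLinearModel.thetaTilde M M₁ M₂ q s) := by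
  obtain ⟨C, hC, h⟩ := DenseLinearModel.exists_rate_le_minimaxLength hM hM₁ hM₂ hc hα₁
  refine ⟨C, hC, fun n p q s hn hpq hsn hs hsp => ?_⟩
  have main := h n p q s hn hpq hsn hs hsp
  exact ⟨main, main.trans (DenseLinearModel.minimaxLength_mono fun θ hθ => ⟨hθ.1.1, hθ.2⟩)⟩
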